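/- Let $1<\alpha<2$, $x_L<x_R$, $T>0$, and let $d$ satisfy $0<d_-\le d(x)\le d_+<\infty$ on $(x_L,x_R)$. For a lower terminal $a\in[-\infty,\infty)$ and $n-1<\gamma<n$ with $n\in\mathbb N$, let $${}_{a}D_x^{\gamma}v(x)=\frac1{\Gamma(n-\gamma)}\frac{d^n}{dx^n}\int_a^x\frac{v(\xi)}{(x-\xi)^{\gamma-n+1}}\,d\xi$$ denote the Riemann–Liouville derivative. Let $u$ be a classical solution of $$\partial_t u=d(x)\,{}_{x_L}D_x^{\alpha}u+f(x,t)\ \text{ on }(x_L,x_R)\times(0,T],\qquad u(x_L,t)=u(x_R,t)=0\ (0\le t\le T),\qquad u(x,0)=\varphi(x)\ (x_L\le x\le x_R),$$ with $u(\cdot,t)$ continuous on $[x_L,x_R]$, and let $u$ be sufficiently smooth in the following sense. * In time: for every $x\in(x_L,x_R)$, $u(x,\cdot)\in C^3[0,T]$ and ${}_{x_L}D_x^{\alpha}u(x,\cdot)\in C^2[0,T]$, with $\partial_t^3u$ and $\partial_t^2\,{}_{x_L}D_x^{\alpha}u$ bounded on $(x_L,x_R)\times[0,T]$. * In space: there is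 a constant $K$ such that for every $t\in[0,T]$ the function $u(\cdot,t)$ on $[x_L,x_R]$ extends to a continuous function $v\in L^1(\mathbb R)$ with $v=0$ on $(-\infty,x_L]$, for which $x\mapsto\int_{-\infty}^x v(\xi)(x-\xi)^{1-\alpha}\,d\xi$ is in $C^4(\mathbb R)$, the derivative ${}_{-\infty}D_x^{\alpha+2}v$ and its Fourier transform $\xi\mapsto\int_{\mathbb R}e^{-2\pi \mathrm{i}x\xi}\,{}_{-\infty}D_x^{\alpha+2}v(x)\,dx$ are in $L^1(\mathbb R)$, and the $L^1$ norm of this Fourier transform is at most $K$. For positive integers $M,N$ put $h=(x_R-x_L)/(M+1)$, $\tau=T/N$, $x_i=x_L+ih$, $t_n=n\tau$, $t_{n-1/2}=(t_{n-1}+t_n)/2$. Let $g_0=1$, $g_k=\bigl(1-\frac{\alpha+1}{k}\bigr)g_{k-1}$ for $k\ge1$, and $w_0=\frac{\alpha}{2}g_0$, $w_k=\frac{\alpha}{2}g_k+\frac{2-\alpha}{2}g_{k-1}$ for $k\ge 1$. Let $D=\mathrm{diag}(d(x_1),\dots,d(x_M))$, and let $G_\alpha$ be the $M\times M$ matrix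 with entries $w_{i-j+1}$ for $j\le i+1$ and $0$ for $j>i+1$. Let the vectors $u^n=(u^n_1,\dots,u^n_M)^{\rm T}$, $0\le n\le N$, solve the scheme $$\frac{u^n-u^{n-1}}{\tau}=\frac1{2h^\alpha}DG_\alpha(u^{n-1}+u^n)+f^{n-\frac12}\quad(1\le n\le N),\qquad u^0_i=\varphi(x_i)\quad(1\le i\le M),$$ where $f^{n-\frac12}=\bigl(f(x_i,t_{n-\frac12})\bigr)_{i=1}^M$. Set $e^n_i=u(x_i,t_n)-u^n_i$ and $\|v\|=\sqrt{h\,v^{\rm T}v}$. **Theorem.** There is a constant $c_2>0$, independent of $M$, $N$ and $n$ (thus of $h$ and $\tau$), such that for all positive integers $M,N$ and all $0\le n\le N$ $$\|e^n\|\le c_2(\tau^2+h^2).$$ -/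

import Mathlib

open scoped FourierTransform Matrix

noncomputable section

namespace OSFDE

/-! ### Fractional integrals and derivatives -/

/-- Riemann-Liouville fractional integral of order `β` with lower terminal `a`:
`(1 / Γ(β)) ∫_a^x v(ξ) / (x - ξ)^(1 - β) dξ`. -/
def rlIntegral (a β : ℝ) (v : ℝ → ℝ) (x : ℝ) : ℝ :=
  1 / Real.Gamma β * ∫ ξ in a..x, v ξ / (x - ξ) ^ (1 - β)

/-- Left Riemann-Liouville derivative of order `α ∈ (1, 2)` with lower terminal `a`:
`(1 / Γ(2 - α)) (d/dx)^2 ∫_a^x v(ξ) / (x - ξ)^(α - 1) dξ`. -/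
def rlDeriv (a α : ℝ) (v : ℝ → ℝ) (x : ℝ) : ℝ :=
  iteratedDeriv 2 (rlIntegral a (2 - α) v) x

/-- Riemann-Liouville fractional integral of order `β` with lower terminal `-∞`. -/
def rlIntegralLine (β : ℝ) (v : ℝ → ℝ) (x : ℝ) : ℝ :=
  1 / Real.Gamma β * ∫ ξ in Set.Iic x, v ξ / (x - ξ) ^ (1 - β)

/-- Riemann-Liouville derivative with lower terminal `-∞` and of order `γ ∈ (3, 4)`:
`(1 / Γ(4 - γ)) (d/dx)^4 ∫_{-∞}^x v(ξ) / (x - ξ)^(γ - 3) dξ`. -/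
def rlDerivLine (γ : ℝ) (v : ℝ → ℝ) (x : ℝ) : ℝ :=
  iteratedDeriv 4 (rlIntegralLine (4 - γ) v) x

/-! ### The continuous problem -/

/-- `u x t` is a classical solution of
`∂u/∂t = d(x) D_x^α u + f` on `(xL, xR) × (0, T]`, `u(xL, t) = u(xR, t) = 0` on `[0, T]`,
`u(x, 0) = φ(x)` on `[xL, xR]`. The time derivative is taken within `[0, T]` (so it is one-sided
at `t = T`), and the second derivative in the Riemann-Liouville derivative is required to exist. -/
structure IsExactSolution (α xL xR T : ℝ) (d φ : ℝ → ℝ) (f u : ℝ → ℝ → ℝ) : Prop where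
  continuousOn : ∀ t ∈ Set.Icc 0 T, ContinuousOn (fun x => u x t) (Set.Icc xL xR)
  differentiableAt_rlIntegral : ∀ t ∈ Set.Ioc 0 T, ∀ x ∈ Set.Ioo xL xR,
    DifferentiableAt ℝ (rlIntegral xL (2 - α) (fun y => u y t)) x
  differentiableAt_deriv_rlIntegral : ∀ t ∈ Set.Ioc 0 T, ∀ x ∈ Set.Ioo xL xR,
    DifferentiableAt ℝ (deriv (rlIntegral xL (2 - α) (fun y => u y t))) x
  equation : ∀ t ∈ Set.Ioc 0 T, ∀ x ∈ Set.Ioo xL xR,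
    HasDerivWithinAt (fun s => u x s)
      (d x * rlDeriv xL α (fun y => u y t) x + f x t) (Set.Icc 0 T) t
  left_boundary : ∀ t ∈ Set.Icc 0 T, u xL t = 0
  right_boundary : ∀ t ∈ Set.Icc 0 T, u xR t = 0
  initial : ∀ x ∈ Set.Icc xL xR, u x 0 = φ x

/-- A function `v` on the line is regular enough for the weighted and shifted Grünwald formula:
`v` is continuous, its derivative of order `α + 2` (lower terminal `-∞`) exists classically, and
`v`, that derivative and the Fourier transform of that derivative are in `L¹(ℝ)`;
the `L¹` norm of the latter is at most `K`. -/
structure IsSpaceRegular (α K : ℝ) (v : ℝ → ℝ) : Prop where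
  continuous : Continuous v
  integrable : MeasureTheory.Integrable v
  contDiff : ContDiff ℝ 4 (rlIntegralLine (4 - (α + 2)) v)
  integrable_deriv : MeasureTheory.Integrable (rlDerivLine (α + 2) v)
  integrable_fourier :
    MeasureTheory.Integrable (𝓕 (fun x : ℝ => ((rlDerivLine (α + 2) v x : ℝ) : ℂ)))
  fourier_bound : ∫ ξ : ℝ, ‖(𝓕 (fun x : ℝ => ((rlDerivLine (α + 2) v x : ℝ) : ℂ))) ξ‖ ≤ K

/-- The regularity meant by a sufficiently smooth solution. In time: for every interior `x`,
`u(x, ·)` is `C^3` and `D_x^α u(x, ·)` is `C^2` on `[0, T]`, with the third and the second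
derivative bounded uniformly in `x`. In space: each `u(·, t)` extends to a function on the line,
zero to the left of `xL`, that is regular in the above sense, uniformly in `t`. -/
structure IsSufficientlySmooth (α xL xR T : ℝ) (u : ℝ → ℝ → ℝ) : Prop where
  time : ∃ K : ℝ, ∀ x ∈ Set.Ioo xL xR,
    ContDiffOn ℝ 3 (fun t => u x t) (Set.Icc 0 T) ∧
    ∀ t ∈ Set.Icc 0 T, |iteratedDerivWithin 3 (fun s => u x s) (Set.Icc 0 T) t| ≤ K
  time_rlDeriv : ∃ K : ℝ, ∀ x ∈ Set.Ioo xL xR,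
    ContDiffOn ℝ 2 (fun t => rlDeriv xL α (fun y => u y t) x) (Set.Icc 0 T) ∧
    ∀ t ∈ Set.Icc 0 T,
      |iteratedDerivWithin 2 (fun s => rlDeriv xL α (fun y => u y s) x) (Set.Icc 0 T) t| ≤ K
  space : ∃ K : ℝ, ∀ t ∈ Set.Icc 0 T, ∃ v : ℝ → ℝ,
    (∀ x ≤ xL, v x = 0) ∧ (∀ x ∈ Set.Icc xL xR, v x = u x t) ∧ IsSpaceRegular α K v

/-! ### The finite difference scheme -/

/-- Coefficients `g_k` of the power series of `(1 - z)^α`. -/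
def grunwald (α : ℝ) : ℕ → ℝ
  | 0 => 1
  | k + 1 => (1 - (α + 1) / ((k : ℝ) + 1)) * grunwald α k

/-- The weights `w_0 = (α/2) g_0`, `w_k = (α/2) g_k + ((2 - α)/2) g_{k-1}`. -/
def weight (α : ℝ) : ℕ → ℝ
  | 0 => α / 2 * grunwald α 0
  | k + 1 => α / 2 * grunwald α (k + 1) + (2 - α) / 2 * grunwald α k

/-- Space step `h = (xR - xL) / (M + 1)`. -/
def spaceStep (xL xR : ℝ) (M : ℕ) : ℝ := (xR - xL) / ((M : ℝ) + 1)

/-- Time step `τ = T / N`. -/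
def timeStep (T : ℝ) (N : ℕ) : ℝ := T / (N : ℝ)

/-- The interior grid points `x_1, …, x_M`, `x_j = xL + j h`; the index `i : Fin M` stands for
`j = i + 1`. -/
def gridPoint (xL xR : ℝ) (M : ℕ) (i : Fin M) : ℝ :=
  xL + ((i : ℕ) + 1 : ℝ) * spaceStep xL xR M

/-- The time levels `t_n = n τ`. -/
def timeLevel (T : ℝ) (N n : ℕ) : ℝ := (n : ℝ) * timeStep T N

/-- The Toeplitz matrix `G_α`, with entry `w_{i-j+1}` at `(i, j)` if `j ≤ i + 1` and `0` above. -/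
def gMatrix (α : ℝ) (M : ℕ) : Matrix (Fin M) (Fin M) ℝ :=
  Matrix.of fun i j => if (j : ℕ) ≤ (i : ℕ) + 1 then weight α ((i : ℕ) + 1 - (j : ℕ)) else 0

/-- `D = diag(d(x_1), …, d(x_M))`. -/
def dMatrix (xL xR : ℝ) (d : ℝ → ℝ) (M : ℕ) : Matrix (Fin M) (Fin M) ℝ :=
  Matrix.diagonal fun i => d (gridPoint xL xR M i)

/-- `U n = (u_1^n, …, u_M^n)`, `0 ≤ n ≤ N`, solves the scheme: `u_i^0 = φ(x_i)` and
`(u^n - u^{n-1}) / τ = (1 / (2 h^α)) D G_α (u^{n-1} + u^n) + f^{n-1/2}` for `1 ≤ n ≤ N`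
(below, `n` stands for `n - 1`). -/
structure IsSchemeSolution (α xL xR T : ℝ) (d φ : ℝ → ℝ) (f : ℝ → ℝ → ℝ) (M N : ℕ)
    (U : ℕ → Fin M → ℝ) : Prop where
  initial : ∀ i, U 0 i = φ (gridPoint xL xR M i)
  step : ∀ n < N,
    (1 / timeStep T N) • (U (n + 1) - U n) =
      (1 / (2 * spaceStep xL xR M ^ α)) •
        ((dMatrix xL xR d M * gMatrix α M) *ᵥ (U n + U (n + 1))) +
      fun i => f (gridPoint xL xR M i) ((timeLevel T N n + timeLevel T N (n + 1)) / 2)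

/-- The discrete `L²` norm `√(h vᵀv)`. -/
def discreteNorm (h : ℝ) {M : ℕ} (v : Fin M → ℝ) : ℝ := √(h * (v ⬝ᵥ v))

end OSFDE

end

/-! ### Stability: sign of the weights, semidefiniteness of `gMatrix`, weighted energy estimate -/

namespace OSFDE

/-! Convergence follows from stability and consistency.

Stability. The product of D and G need not be negative semidefinite, but G itself is
(`dotProduct_gMatrix_mulVec_nonpos`): its symmetric part has nonnegative off-diagonal entries and
nonpositive row sums. Testing the error equation with D⁻¹(eⁿ⁻¹ + eⁿ) removes D, so the norm weighted
by 1/d grows in one step by at most τ times the weighted norm of the residual (`sqrt_energy_step`).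
The bounds on d make this norm equivalent to the unweighted one.

Consistency in time is Taylor expansion about the midpoint. Consistency in space is a Fourier
argument (`exists_grunwald_error_le`). The weights have generating function (1 - ζ)^α (α/2 + (2-α)/2
ζ), so the shifted difference operator acts on e^{zx} through `symbol α (h z)`, and the symbol
differs from z^α by O(|z|^{α+2}) (`exists_symbol_sub_le`). A causal v is the fractional integral of
order α + 2 of q, its derivative of that order, so formally the error at x is the integral of q̂(ξ)
e^{2πixξ} h^{-α} z^{-(α+2)} (symbol(hz) - (hz)^α) at z = 2πiξ. This is at most C h² times the L¹
norm of q̂.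

On the imaginary axis the kernel of the fractional integral is not integrable and z^{-(α+2)} is
singular at 0. The computation is therefore done on the line Re z = σ > 0, that is, with the kernel
damped by e^{-σy}. The resulting bound does not depend on σ, and σ → 0⁺ recovers the undamped error.
Causality makes the sums finite and supplies domination in the limit. -/

open Finset in
theorem grunwald_succ_eq_neg_sum (α : ℝ) (n : ℕ) :
    grunwald α (n + 1) = -(α / ((n : ℝ) + 1)) * ∑ k ∈ range (n + 1), grunwald α k := by
  induction n with
  | zero => simp [grunwald]
  | succ n ih =>
    rw [sum_range_succ, grunwald]
    have h1 : (n : ℝ) + 1 ≠ 0 := by positivity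
    have h2 : (n : ℝ) + 1 + 1 ≠ 0 := by positivity
    -- The inductive step solves the hypothesis for the partial sum, which divides by α.
    by_cases hα : α = 0
    · subst hα
      rw [zero_div, neg_zero, zero_mul] at ih
      rw [ih]; simp
    · have h3 : ∑ k ∈ range (n + 1), grunwald α k = -((n + 1) / α) * grunwald α (n + 1) := by
        rw [ih]; field_simp
      rw [h3]
      push_cast
      field_simp
      ring

/-- Adding the term of index m multiplies the partial sum by 1 - α/m, which is nonnegative for m ≥
2; the first two terms add up to 1 - α < 0. -/
theorem sum_grunwald_nonpos {α : ℝ} (h1 : 1 < α) (h2 : α < 2) (n : ℕ) :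
    ∑ k ∈ Finset.range (n + 2), grunwald α k ≤ 0 := by
  induction n with
  | zero => simp [Finset.sum_range_succ, grunwald]; linarith
  | succ n ih =>
    rw [Finset.sum_range_succ, grunwald_succ_eq_neg_sum]
    have h : α / (((n + 1 : ℕ) : ℝ) + 1) ≤ 1 := by
      rw [div_le_one (by positivity)]; push_cast; linarith [(Nat.cast_nonneg n : (0:ℝ) ≤ n)]
    nlinarith [h, ih]

theorem grunwald_nonneg {α : ℝ} (h1 : 1 < α) (h2 : α < 2) (n : ℕ) :
    0 ≤ grunwald α (n + 2) := by
  rw [grunwald_succ_eq_neg_sum]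
  have := sum_grunwald_nonpos h1 h2 n
  have h : 0 ≤ α / (((n + 1 : ℕ) : ℝ) + 1) := by positivity
  nlinarith

theorem weight_nonneg {α : ℝ} (h1 : 1 < α) (h2 : α < 2) (n : ℕ) : 0 ≤ weight α (n + 3) := by
  have ha := grunwald_nonneg h1 h2 n
  have hb := grunwald_nonneg h1 h2 (n + 1)
  rw [weight]
  have : 0 ≤ (2 - α) / 2 := by linarith
  positivity

/-- For α close to 1 the weight of index 2 is negative. Only this sum, which is what occurs next to
the diagonal of the symmetrized matrix, has a sign throughout. -/
theorem weight_zero_add_weight_two_nonneg {α : ℝ} (h1 : 1 < α) :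
    0 ≤ weight α 0 + weight α 2 := by
  have : weight α 0 + weight α 2 = α * (α + 2) * (α - 1) / 4 := by
    simp [weight, grunwald]; ring
  rw [this]
  have : 0 < α - 1 := by linarith
  positivity

theorem weight_one_nonpos {α : ℝ} (h1 : 1 < α) : weight α 1 ≤ 0 := by
  simp [weight, grunwald]; nlinarith

theorem sum_weight_eq (α : ℝ) (n : ℕ) :
    ∑ k ∈ Finset.range (n + 1), weight α k =
      α / 2 * ∑ k ∈ Finset.range (n + 1), grunwald α k +
        (2 - α) / 2 * ∑ k ∈ Finset.range n, grunwald α k := by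
  rw [Finset.sum_range_succ', Finset.sum_range_succ', Finset.mul_sum]
  simp only [weight, Finset.sum_add_distrib, Finset.mul_sum, mul_add]
  ring

theorem sum_weight_nonpos {α : ℝ} (h1 : 1 < α) (h2 : α < 2) (n : ℕ) :
    ∑ k ∈ Finset.range (n + 3), weight α k ≤ 0 := by
  rw [sum_weight_eq]
  have ha := sum_grunwald_nonpos h1 h2 n
  have hb := sum_grunwald_nonpos h1 h2 (n + 1)
  have : 0 ≤ (2 - α) / 2 := by linarith
  nlinarith

/-- The sum of the entries of `G_α` at the two positions at distance `m + 1` from the diagonal. -/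
noncomputable def offDiag (α : ℝ) : ℕ → ℝ
  | 0 => weight α 0 + weight α 2
  | m + 1 => weight α (m + 3)

theorem offDiag_nonneg {α : ℝ} (h1 : 1 < α) (h2 : α < 2) (m : ℕ) : 0 ≤ offDiag α m := by
  cases m with
  | zero => exact weight_zero_add_weight_two_nonneg h1
  | succ m => exact weight_nonneg h1 h2 m

/-- Together with `weight α 1`, these entries form a partial sum of the weights, which is
nonpositive once it has at least three terms. -/
theorem sum_offDiag_le {α : ℝ} (h1 : 1 < α) (h2 : α < 2) (n : ℕ) :
    ∑ m ∈ Finset.range n, offDiag α m ≤ -weight α 1 := by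
  have key : ∀ n, ∑ m ∈ Finset.range (n + 1), offDiag α m ≤ -weight α 1 := by
    intro n
    have := sum_weight_nonpos h1 h2 n
    rw [Finset.sum_range_succ', Finset.sum_range_succ', Finset.sum_range_succ'] at this
    rw [Finset.sum_range_succ']
    simp only [offDiag]
    linarith
  cases n with
  | zero => simpa using weight_one_nonpos h1
  | succ n => exact key n

theorem gMatrix_add_transpose (α : ℝ) {M : ℕ} (i j : Fin M) :
    gMatrix α M i j + gMatrix α M j i =
      if (j : ℕ) < i then offDiag α (i - j - 1)
      else if (i : ℕ) < j then offDiag α (j - i - 1) else 2 * weight α 1 := by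
  simp only [gMatrix, Matrix.of_apply]
  have key : ∀ a b : ℕ, b < a → (if b ≤ a + 1 then weight α (a + 1 - b) else 0) +
      (if a ≤ b + 1 then weight α (b + 1 - a) else 0) = offDiag α (a - b - 1) := by
    intro a b h
    obtain ⟨c, rfl⟩ := Nat.exists_eq_add_of_lt h
    rw [if_pos (by omega), show b + c + 1 + 1 - b = c + 2 by omega,
      show b + c + 1 - b - 1 = c by omega]
    cases c with
    | zero => simp [offDiag, add_comm]
    | succ c => rw [if_neg (by omega)]; simp [offDiag]
  split_ifs with h1 h2 h3 h4 h5 h6 h7 <;> try omega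
  all_goals first
    | (have := key i j (by assumption); split_ifs at this; omega)
    | (have := key j i (by assumption); split_ifs at this; linarith)
    | (have h : (i : ℕ) = j := by omega
       rw [h]; simp; ring)

open Finset in
theorem sum_ite_lt_le {a : ℕ → ℝ} {B : ℝ} (hB : ∀ n, ∑ m ∈ range n, a m ≤ B) {M : ℕ}
    (i : Fin M) :
    ∑ j : Fin M, (if (j : ℕ) < i then a (i - j - 1) else 0) ≤ B := by
  rw [Fin.sum_univ_eq_sum_range (fun j => if j < (i : ℕ) then a (i - j - 1) else 0) M,
    ← sum_filter]
  have : (range M).filter (fun j => j < (i : ℕ)) = range i := by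
    ext j; simp; omega
  rw [this]
  have := sum_range_reflect a i
  calc ∑ j ∈ range (i : ℕ), a (i - j - 1) = ∑ j ∈ range (i : ℕ), a (i - 1 - j) :=
        sum_congr rfl fun j _ => by congr 1; omega
    _ = ∑ j ∈ range (i : ℕ), a j := this
    _ ≤ B := hB _

open Finset in
theorem sum_ite_gt_le {a : ℕ → ℝ} {B : ℝ}
    (hB : ∀ n, ∑ m ∈ range n, a m ≤ B) {M : ℕ} (i : Fin M) :
    ∑ j : Fin M, (if (i : ℕ) < j then a (j - i - 1) else 0) ≤ B := by
  have := sum_ite_lt_le hB i.rev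
  rw [← Equiv.sum_comp Fin.revPerm]
  refine le_trans (le_of_eq (sum_congr rfl fun j _ => ?_)) this
  have h1 := i.isLt
  have h2 := j.isLt
  simp only [Fin.revPerm_apply, Fin.val_rev]
  split_ifs <;> first | omega | rfl | (congr 1; omega)

open Finset in
/-- The matrix `G_α` is negative semidefinite. -/
theorem dotProduct_gMatrix_mulVec_nonpos {α : ℝ} (h1 : 1 < α) (h2 : α < 2) {M : ℕ}
    (x : Fin M → ℝ) : x ⬝ᵥ (gMatrix α M *ᵥ x) ≤ 0 := by
  set G := gMatrix α M
  have hform : x ⬝ᵥ (G *ᵥ x) = ∑ i, ∑ j, G i j * (x i * x j) := by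
    simp only [dotProduct, Matrix.mulVec, mul_sum]
    exact sum_congr rfl fun i _ => sum_congr rfl fun j _ => by ring
  have hsymm : ∑ i, ∑ j, G i j * (x i * x j) = ∑ i, ∑ j, G j i * (x i * x j) := by
    rw [sum_comm]
    exact sum_congr rfl fun i _ => sum_congr rfl fun j _ => by ring
  have hsq : ∑ i, ∑ j, (G i j + G j i) * (x j * x j) = ∑ i, ∑ j, (G i j + G j i) * (x i * x i) := by
    rw [sum_comm]
    exact sum_congr rfl fun i _ => sum_congr rfl fun j _ => by ring
  -- Off the diagonal 2xy ≤ x² + y² is multiplied by a nonnegative entry; on the diagonal, where the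
  -- entry is nonpositive, both sides agree.
  have hle : ∑ i, ∑ j, (G i j + G j i) * (2 * (x i * x j)) ≤
      ∑ i, ∑ j, (G i j + G j i) * (x i * x i + x j * x j) := by
    refine sum_le_sum fun i _ => sum_le_sum fun j _ => ?_
    rw [gMatrix_add_transpose]
    split_ifs with ha hb
    · exact mul_le_mul_of_nonneg_left (by nlinarith [sq_nonneg (x i - x j)])
        (offDiag_nonneg h1 h2 _)
    · exact mul_le_mul_of_nonneg_left (by nlinarith [sq_nonneg (x i - x j)])
        (offDiag_nonneg h1 h2 _)
    · have : i = j := Fin.ext (by omega)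
      subst this; linarith
  have hrow : ∀ i, ∑ j, (G i j + G j i) ≤ 0 := by
    intro i
    have e : ∀ j, G i j + G j i = (if (j : ℕ) < i then offDiag α (i - j - 1) else 0) +
        (if (i : ℕ) < j then offDiag α (j - i - 1) else 0) +
        (if j = i then 2 * weight α 1 else 0) := by
      intro j
      rw [gMatrix_add_transpose]
      by_cases hij : j = i
      · subst hij; simp
      · have : (j : ℕ) ≠ i := fun h => hij (Fin.ext h)
        split_ifs <;> first | omega | simp
    simp only [e, sum_add_distrib, sum_ite_eq', mem_univ, if_true]
    have ha := sum_ite_lt_le (sum_offDiag_le h1 h2) i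
    have hb := sum_ite_gt_le (sum_offDiag_le h1 h2) i
    linarith
  have hfin : ∑ i, ∑ j, (G i j + G j i) * (x i * x i) ≤ 0 := by
    refine sum_nonpos fun i _ => ?_
    rw [← sum_mul]
    exact mul_nonpos_of_nonpos_of_nonneg (hrow i) (mul_self_nonneg _)
  have h4 : 4 * (x ⬝ᵥ (G *ᵥ x)) = ∑ i, ∑ j, (G i j + G j i) * (2 * (x i * x j)) := by
    rw [hform]
    have : ∑ i, ∑ j, (G i j + G j i) * (2 * (x i * x j)) =
        2 * ∑ i, ∑ j, G i j * (x i * x j) + 2 * ∑ i, ∑ j, G j i * (x i * x j) := by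
      simp only [mul_sum, ← sum_add_distrib]
      exact sum_congr rfl fun i _ => sum_congr rfl fun j _ => by ring
    rw [this, ← hsymm]; ring
  have h5 : ∑ i, ∑ j, (G i j + G j i) * (x i * x i + x j * x j) =
      2 * ∑ i, ∑ j, (G i j + G j i) * (x i * x i) := by
    simp only [mul_add, sum_add_distrib] at hsq ⊢
    linarith
  linarith

/-- One step of the energy estimate for the Crank-Nicolson scheme, in the norm weighted by
the reciprocals of the (positive) coefficients. -/
theorem sqrt_energy_step {α : ℝ} (h1 : 1 < α) (h2 : α < 2) {M : ℕ} {δ e e' ρ : Fin M → ℝ}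
    (hδ : ∀ i, 0 < δ i) {τ c : ℝ} (hτ : 0 < τ) (hc : 0 ≤ c)
    (h : ∀ i, (e' i - e i) / τ = c * (δ i * (gMatrix α M *ᵥ (e + e')) i) + ρ i) :
    √(∑ i, e' i ^ 2 / δ i) ≤ √(∑ i, e i ^ 2 / δ i) + τ * √(∑ i, ρ i ^ 2 / δ i) := by
  have hG := dotProduct_gMatrix_mulVec_nonpos h1 h2 (e + e')
  set a := √(∑ i, e' i ^ 2 / δ i)
  set b := √(∑ i, e i ^ 2 / δ i)
  set r := √(∑ i, ρ i ^ 2 / δ i)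
  have nn : ∀ v : Fin M → ℝ, 0 ≤ ∑ i, v i ^ 2 / δ i := fun v =>
    Finset.sum_nonneg fun i _ => div_nonneg (sq_nonneg _) (hδ i).le
  have ha : a ^ 2 = ∑ i, e' i ^ 2 / δ i := Real.sq_sqrt (nn _)
  have hb : b ^ 2 = ∑ i, e i ^ 2 / δ i := Real.sq_sqrt (nn _)
  -- The scheme is tested with (e + e')/δ, so that δ cancels and the quadratic form of G alone
  -- remains.
  have hid : a ^ 2 - b ^ 2 = τ * c * ((e + e') ⬝ᵥ (gMatrix α M *ᵥ (e + e'))) +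
      τ * (∑ i, ρ i * e i / δ i) + τ * (∑ i, ρ i * e' i / δ i) := by
    rw [ha, hb, ← Finset.sum_sub_distrib, dotProduct, Finset.mul_sum, Finset.mul_sum,
      Finset.mul_sum, ← Finset.sum_add_distrib, ← Finset.sum_add_distrib]
    refine Finset.sum_congr rfl fun i _ => ?_
    have hi : e' i - e i = τ * (c * (δ i * (gMatrix α M *ᵥ (e + e')) i) + ρ i) := by
      rw [← h i]; field_simp
    have hne := (hδ i).ne'
    simp only [Pi.add_apply]
    have : e' i ^ 2 / δ i - e i ^ 2 / δ i = (e' i - e i) * (e i + e' i) / δ i := by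
      field_simp; ring
    rw [this, hi]
    field_simp
    ring
  have cs : ∀ v : Fin M → ℝ, ∑ i, ρ i * v i / δ i ≤ r * √(∑ i, v i ^ 2 / δ i) := by
    intro v
    rw [← Real.sqrt_mul (nn ρ)]
    refine Real.le_sqrt_of_sq_le ?_
    have := Finset.sum_mul_sq_le_sq_mul_sq Finset.univ (fun i => ρ i / √(δ i))
      (fun i => v i / √(δ i))
    simp only [div_pow, Real.sq_sqrt (hδ _).le, div_mul_div_comm,
      Real.mul_self_sqrt (hδ _).le] at this
    exact this
  have c1 := cs e
  have c2 := cs e'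
  have ha0 : 0 ≤ a := Real.sqrt_nonneg _
  have hb0 : 0 ≤ b := Real.sqrt_nonneg _
  have hr0 : 0 ≤ r := Real.sqrt_nonneg _
  have hmain : a ^ 2 - b ^ 2 ≤ τ * r * (a + b) := by
    have t1 : τ * c * ((e + e') ⬝ᵥ (gMatrix α M *ᵥ (e + e'))) ≤ 0 :=
      mul_nonpos_of_nonneg_of_nonpos (by positivity) hG
    have t2 := mul_le_mul_of_nonneg_left c1 hτ.le
    have t3 := mul_le_mul_of_nonneg_left c2 hτ.le
    rw [hid]
    calc _ ≤ 0 + τ * (r * b) + τ * (r * a) := by gcongr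
      _ = _ := by ring
  -- It remains to cancel a + b in (a - b)(a + b) ≤ τ r (a + b). The negated claim forces a + b > 0.
  by_contra hcon
  push Not at hcon
  have hpos : 0 < a + b := by nlinarith [mul_nonneg hτ.le hr0]
  nlinarith [mul_pos hpos (sub_pos.mpr hcon)]

end OSFDE

/-! ### Taylor estimates in time -/

namespace OSFDE

open Set

theorem iteratedDerivWithin_Icc_subset {f : ℝ → ℝ} {a b c e : ℝ} {n : ℕ} (hab : a < b)
    (hsub : Icc a b ⊆ Icc c e) (hf : ContDiffOn ℝ n f (Icc c e)) {x : ℝ} (hx : x ∈ Icc a b) :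
    iteratedDerivWithin n f (Icc a b) x = iteratedDerivWithin n f (Icc c e) x := by
  have hce : c < e := by
    have h1 := hsub (left_mem_Icc.2 hab.le)
    have h2 := hsub (right_mem_Icc.2 hab.le)
    exact h1.1.trans_lt (hab.trans_le h2.2)
  rw [iteratedDerivWithin, iteratedDerivWithin,
    iteratedFDerivWithin_subset hsub (uniqueDiffOn_Icc hab) (uniqueDiffOn_Icc hce) hf hx]

/-- The Crank-Nicolson difference quotient is second order accurate at the midpoint. -/
theorem abs_slope_sub_deriv_midpoint_le {p : ℝ → ℝ} {T K a b : ℝ}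
    (hp : ContDiffOn ℝ 3 p (Icc 0 T))
    (hK : ∀ t ∈ Icc 0 T, |iteratedDerivWithin 3 p (Icc 0 T) t| ≤ K)
    (ha : 0 ≤ a) (hab : a < b) (hb : b ≤ T) :
    |(p b - p a) / (b - a) - derivWithin p (Icc 0 T) ((a + b) / 2)| ≤ K * (b - a) ^ 2 := by
  have hsub : Icc a b ⊆ Icc 0 T := Icc_subset_Icc ha hb
  have hmem : (a + b) / 2 ∈ Icc a b := ⟨by linarith, by linarith⟩
  have ha' : a ∈ Icc a b := left_mem_Icc.2 hab.le
  have hpab : ContDiffOn ℝ 3 p (Icc a b) := hp.mono hsub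
  have hud := uniqueDiffOn_Icc hab
  have hKab : ∀ y ∈ Icc a b, ‖iteratedDerivWithin 3 p (Icc a b) y‖ ≤ K := fun y hy => by
    rw [iteratedDerivWithin_Icc_subset hab hsub hp hy]; exact hK y (hsub hy)
  have hK0 : 0 ≤ K := (norm_nonneg _).trans (hKab a ha')
  set q := derivWithin p (Icc a b) with hq
  have hqc : ContDiffOn ℝ 2 q (Icc a b) := hpab.derivWithin hud (by norm_num)
  have hit : ∀ n, iteratedDerivWithin n q (Icc a b) = iteratedDerivWithin (n + 1) p (Icc a b) :=
    fun n => by rw [iteratedDerivWithin_succ']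
  have t1 := taylor_mean_remainder_bound (n := 2) hab.le (by simpa using! hpab)
    (right_mem_Icc.2 hab.le) hKab
  have t2 := taylor_mean_remainder_bound (f := q) (n := 1) hab.le (by simpa using! hqc) hmem
    (fun y hy => by rw [hit]; exact hKab y hy)
  simp only [taylorWithinEval_succ, taylor_within_zero_eval, Real.norm_eq_abs, hit] at t1 t2
  have hm : derivWithin p (Icc 0 T) ((a + b) / 2) = q ((a + b) / 2) := by
    have := iteratedDerivWithin_Icc_subset (n := 1) hab hsub (hp.of_le (by norm_num)) hmem
    simpa [iteratedDerivWithin_one] using this.symm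
  have h1 : iteratedDerivWithin 1 p (Icc a b) a = q a := by rw [iteratedDerivWithin_one]
  rw [hm]
  rw [h1] at t1
  set A := iteratedDerivWithin 2 p (Icc a b) a with hA
  have h2 : iteratedDerivWithin (0 + 1 + 1) p (Icc a b) a = A := rfl
  have h3 : iteratedDerivWithin (1 + 1) p (Icc a b) a = A := rfl
  norm_num [Nat.factorial, h2, h3, h1, ← hA] at t1 t2
  have hd : 0 < b - a := by linarith
  rw [show (a + b) / 2 - a = (b - a) / 2 by ring] at t2
  set s := b - a
  -- Both expansions at a, of p up to b and of p' up to the midpoint, contribute q a + s A / 2,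
  -- which cancels; only the remainders are left.
  have e1 : (p b - p a) / s - q ((a + b) / 2) =
      (p b - (p a + s * q a + 1 / 2 * s ^ 2 * A)) / s - (q ((a + b) / 2) - (q a + s / 2 * A)) := by
    field_simp; ring
  rw [e1]
  refine (abs_sub _ _).trans ?_
  rw [abs_div, abs_of_pos hd]
  have e2 : |p b - (p a + s * q a + 1 / 2 * s ^ 2 * A)| / s ≤ K * s ^ 2 / 2 := by
    rw [div_le_iff₀ hd]
    refine t1.trans (le_of_eq ?_)
    ring
  have e3 : |q ((a + b) / 2) - (q a + s / 2 * A)| ≤ K * s ^ 2 / 4 := by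
    refine t2.trans (le_of_eq ?_)
    ring
  nlinarith [mul_nonneg hK0 (sq_nonneg s)]

/-- The average of the values at the end points is second order accurate at the midpoint. -/
theorem abs_average_sub_midpoint_le {p : ℝ → ℝ} {T K a b : ℝ}
    (hp : ContDiffOn ℝ 2 p (Icc 0 T))
    (hK : ∀ t ∈ Icc 0 T, |iteratedDerivWithin 2 p (Icc 0 T) t| ≤ K)
    (ha : 0 ≤ a) (hab : a < b) (hb : b ≤ T) :
    |(p a + p b) / 2 - p ((a + b) / 2)| ≤ K * (b - a) ^ 2 := by
  have hsub : Icc a b ⊆ Icc 0 T := Icc_subset_Icc ha hb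
  have hmem : (a + b) / 2 ∈ Icc a b := ⟨by linarith, by linarith⟩
  have hpab : ContDiffOn ℝ 2 p (Icc a b) := hp.mono hsub
  have hKab : ∀ y ∈ Icc a b, ‖iteratedDerivWithin 2 p (Icc a b) y‖ ≤ K := fun y hy => by
    rw [iteratedDerivWithin_Icc_subset hab hsub hp hy]; exact hK y (hsub hy)
  have hK0 : 0 ≤ K := (norm_nonneg _).trans (hKab a (left_mem_Icc.2 hab.le))
  have t1 := taylor_mean_remainder_bound (n := 1) hab.le (by simpa using! hpab)
    (right_mem_Icc.2 hab.le) hKab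
  have t2 := taylor_mean_remainder_bound (n := 1) hab.le (by simpa using! hpab) hmem hKab
  simp only [taylorWithinEval_succ, taylor_within_zero_eval, Real.norm_eq_abs] at t1 t2
  norm_num [Nat.factorial] at t1 t2
  rw [show (a + b) / 2 - a = (b - a) / 2 by ring] at t2
  set s := b - a
  set A := derivWithin p (Icc a b) a
  have e1 : (p a + p b) / 2 - p ((a + b) / 2) =
      (p b - (p a + s * A)) / 2 - (p ((a + b) / 2) - (p a + s / 2 * A)) := by ring
  rw [e1]
  refine (abs_sub _ _).trans ?_
  rw [abs_div, abs_two]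
  nlinarith [mul_nonneg hK0 (sq_nonneg s)]

end OSFDE

/-! ### Fractional integrals of causal functions -/

namespace OSFDE

open MeasureTheory Set Filter Topology
open scoped Convolution

/-- The kernel `y_+^(β - 1) / Γ(β)` of the fractional integral of order `β`. -/
noncomputable def rlKernel (β : ℝ) : ℝ → ℝ :=
  indicator (Ioi 0) fun y => y ^ (β - 1) / Real.Gamma β

/-- The fractional integral of order `β` with lower terminal `-∞`, as a convolution. -/
noncomputable def fracInt (β : ℝ) (v : ℝ → ℝ) (x : ℝ) : ℝ := ∫ y, rlKernel β y * v (x - y)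

theorem rlKernel_of_pos (β : ℝ) {y : ℝ} (hy : 0 < y) :
    rlKernel β y = y ^ (β - 1) / Real.Gamma β := indicator_of_mem (show y ∈ Ioi 0 from hy) _

theorem rlKernel_of_nonpos (β : ℝ) {y : ℝ} (hy : y ≤ 0) : rlKernel β y = 0 :=
  indicator_of_notMem (show y ∉ Ioi 0 from not_lt.2 hy) _

theorem rlKernel_nonneg {β : ℝ} (hβ : 0 < β) (y : ℝ) : 0 ≤ rlKernel β y :=
  indicator_nonneg (fun x (hx : 0 < x) =>
    div_nonneg (Real.rpow_nonneg hx.le _) (Real.Gamma_pos_of_pos hβ).le) _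

theorem measurable_rlKernel (β : ℝ) : Measurable (rlKernel β) :=
  Measurable.indicator (by fun_prop) measurableSet_Ioi

theorem integrableOn_rlKernel {β : ℝ} (hβ : 0 < β) (X : ℝ) : IntegrableOn (rlKernel β) (Iic X) := by
  have h1 : IntegrableOn (fun y : ℝ => y ^ (β - 1) / Real.Gamma β) (Ioc 0 (max X 0)) := by
    have := intervalIntegral.intervalIntegrable_rpow' (a := 0) (b := max X 0) (r := β - 1)
      (by linarith)
    rw [intervalIntegrable_iff_integrableOn_Ioc_of_le (le_max_right _ _)] at this
    exact this.div_const _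
  have h2 : IntegrableOn (rlKernel β) (Iic (max X 0)) := by
    rw [IntegrableOn, rlKernel, integrable_indicator_iff measurableSet_Ioi, IntegrableOn,
      Measure.restrict_restrict measurableSet_Ioi, Ioi_inter_Iic]
    exact h1
  exact h2.mono_set (Iic_subset_Iic.2 (le_max_left _ _))

theorem exists_bound_of_causal {v : ℝ → ℝ} (hv : Continuous v) {a : ℝ} (ha : ∀ x ≤ a, v x = 0)
    (X : ℝ) : ∃ B, ∀ x ≤ X, |v x| ≤ B := by
  obtain ⟨B, hB⟩ := isCompact_Icc.exists_bound_of_continuousOn (s := Icc a X) hv.continuousOn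
  refine ⟨max B 0, fun x hx => ?_⟩
  rcases le_total x a with h | h
  · rw [ha x h, abs_zero]; exact le_max_right _ _
  · exact (hB x ⟨h, hx⟩).trans (le_max_left _ _)

/-- For x ≤ X the factor v (x - y) vanishes when y > X - a, so only a bounded piece of the kernel
matters, where it is integrable and v is bounded. The majorant is uniform in x and gives continuity
by dominated convergence. -/
theorem exists_integrable_bound {β : ℝ} (hβ : 0 < β) {v : ℝ → ℝ} (hv : Continuous v) {a : ℝ}
    (ha : ∀ x ≤ a, v x = 0) (X : ℝ) : ∃ g : ℝ → ℝ, Integrable g ∧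
      ∀ x ≤ X, ∀ y, ‖rlKernel β y * v (x - y)‖ ≤ g y := by
  obtain ⟨B, hB⟩ := exists_bound_of_causal hv ha X
  refine ⟨indicator (Iic (X - a)) fun y => rlKernel β y * B,
    IntegrableOn.integrable_indicator ((integrableOn_rlKernel hβ _).mul_const _)
      measurableSet_Iic, fun x hx y => ?_⟩
  have hk := rlKernel_nonneg hβ y
  rcases le_or_gt y 0 with hy | hy
  · simp [rlKernel_of_nonpos _ hy, indicator]
  · by_cases hya : y ≤ X - a
    · rw [indicator_of_mem (show y ∈ Iic _ from hya), norm_mul, Real.norm_of_nonneg hk]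
      exact mul_le_mul_of_nonneg_left (hB _ (by linarith)) hk
    · rw [indicator_of_notMem (show y ∉ Iic _ from hya), ha (x - y) (by linarith), mul_zero,
        norm_zero]

theorem integrable_rlKernel_mul {β : ℝ} (hβ : 0 < β) {v : ℝ → ℝ} (hv : Continuous v) {a : ℝ}
    (ha : ∀ x ≤ a, v x = 0) (x : ℝ) : Integrable fun y => rlKernel β y * v (x - y) := by
  obtain ⟨g, hg, hb⟩ := exists_integrable_bound hβ hv ha x
  refine hg.mono' ?_ (Eventually.of_forall (hb x le_rfl))
  exact ((measurable_rlKernel β).mul (hv.measurable.comp (by fun_prop))).aestronglyMeasurable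

theorem continuous_fracInt {β : ℝ} (hβ : 0 < β) {v : ℝ → ℝ} (hv : Continuous v) {a : ℝ}
    (ha : ∀ x ≤ a, v x = 0) : Continuous (fracInt β v) := by
  refine continuous_iff_continuousAt.2 fun x₀ => ?_
  obtain ⟨g, hg, hb⟩ := exists_integrable_bound hβ hv ha (x₀ + 1)
  refine continuousAt_of_dominated (bound := g) (Eventually.of_forall fun x => ?_) ?_ hg
    (Eventually.of_forall fun y => ?_)
  · exact ((measurable_rlKernel β).mul (hv.measurable.comp (by fun_prop))).aestronglyMeasurable
  · filter_upwards [Iic_mem_nhds (lt_add_one x₀)] with x hx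
    exact Eventually.of_forall (hb x hx)
  · exact (continuous_const.mul (hv.comp (by fun_prop))).continuousAt

theorem fracInt_eq_zero {β : ℝ} {v : ℝ → ℝ} {a : ℝ} (ha : ∀ x ≤ a, v x = 0) :
    ∀ x ≤ a, fracInt β v x = 0 := by
  intro x hx
  rw [fracInt]
  refine integral_eq_zero_of_ae (Eventually.of_forall fun y => ?_)
  rcases le_or_gt y 0 with hy | hy
  · simp [rlKernel_of_nonpos _ hy]
  · simp [ha (x - y) (by linarith)]

/-- This is the Beta integral scaled to (0, t), with B(β, γ) = Γ(β)Γ(γ)/Γ(β + γ). -/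
theorem integral_rlKernel_mul_rlKernel {β γ : ℝ} (hβ : 0 < β) (hγ : 0 < γ) (t : ℝ) :
    ∫ y, rlKernel β y * rlKernel γ (t - y) = rlKernel (β + γ) t := by
  have hind : (fun y => rlKernel β y * rlKernel γ (t - y)) = indicator (Ioo 0 t) fun y =>
      y ^ (β - 1) * (t - y) ^ (γ - 1) / (Real.Gamma β * Real.Gamma γ) := by
    ext y
    by_cases hy : y ∈ Ioo 0 t
    · rw [indicator_of_mem hy, rlKernel_of_pos _ hy.1, rlKernel_of_pos _ (sub_pos.2 hy.2)]
      ring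
    · rw [indicator_of_notMem hy]
      rcases le_or_gt y 0 with h | h
      · rw [rlKernel_of_nonpos _ h, zero_mul]
      · rw [rlKernel_of_nonpos γ (y := t - y), mul_zero]
        by_contra hc
        exact hy ⟨h, by linarith⟩
  rw [hind, integral_indicator measurableSet_Ioo]
  rcases le_or_gt t 0 with ht | ht
  · rw [Ioo_eq_empty (not_lt.2 ht), rlKernel_of_nonpos _ ht]; simp
  rw [integral_div, ← integral_Ioc_eq_integral_Ioo, ← intervalIntegral.integral_of_le ht.le,
    rlKernel_of_pos _ ht]
  have hb := Complex.betaIntegral_scaled β γ ht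
  have hG := Complex.Gamma_mul_Gamma_eq_betaIntegral (s := β) (t := γ) (by simpa) (by simpa)
  have hne : Real.Gamma (β + γ) ≠ 0 := (Real.Gamma_pos_of_pos (by positivity)).ne'
  have hne1 : Real.Gamma β ≠ 0 := (Real.Gamma_pos_of_pos hβ).ne'
  have hne2 : Real.Gamma γ ≠ 0 := (Real.Gamma_pos_of_pos hγ).ne'
  have hc : ((∫ y in (0 : ℝ)..t, y ^ (β - 1) * (t - y) ^ (γ - 1) : ℝ) : ℂ) =
      ∫ y in (0 : ℝ)..t, (y : ℂ) ^ ((β : ℂ) - 1) * ((t : ℂ) - y) ^ ((γ : ℂ) - 1) := by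
    rw [← intervalIntegral.integral_ofReal]
    refine intervalIntegral.integral_congr fun y hy => ?_
    rw [uIcc_of_le ht.le] at hy
    have h2 : 0 ≤ t - y := sub_nonneg.2 hy.2
    rw [Complex.ofReal_mul, Complex.ofReal_cpow hy.1, Complex.ofReal_cpow h2]
    push_cast
    rfl
  have key : (Real.Gamma (β + γ)) * (∫ y in (0 : ℝ)..t, y ^ (β - 1) * (t - y) ^ (γ - 1)) =
      t ^ (β + γ - 1) * (Real.Gamma β * Real.Gamma γ) := by
    have : ((Real.Gamma (β + γ) * (∫ y in (0 : ℝ)..t, y ^ (β - 1) * (t - y) ^ (γ - 1)) : ℝ) : ℂ) =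
      ((t ^ (β + γ - 1) * (Real.Gamma β * Real.Gamma γ) : ℝ) : ℂ) := by
      push_cast
      rw [Complex.ofReal_cpow ht.le, ← Complex.Gamma_ofReal, ← Complex.Gamma_ofReal,
        ← Complex.Gamma_ofReal, hG, hc, hb]
      push_cast
      ring
    exact_mod_cast this
  rw [div_eq_div_iff (by positivity) hne, mul_comm, key]

/-- The semigroup property of fractional integrals. -/
theorem fracInt_fracInt {β γ : ℝ} (hβ : 0 < β) (hγ : 0 < γ) {v : ℝ → ℝ} (hv : Continuous v)
    {a : ℝ} (ha : ∀ x ≤ a, v x = 0) : fracInt β (fracInt γ v) = fracInt (β + γ) v := by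
  ext x
  set L := ContinuousLinearMap.mul ℝ ℝ
  have hconv : ∀ (f g : ℝ → ℝ), (f ⋆[L, volume] g) = fun x => ∫ y, f y * g (x - y) :=
    fun f g => rfl
  have hn : ∀ δ : ℝ, 0 < δ → (fun x => ‖rlKernel δ x‖) = rlKernel δ := fun δ hδ => by
    ext y; exact Real.norm_of_nonneg (rlKernel_nonneg hδ y)
  have hva : ∀ x ≤ a, ‖v x‖ = 0 := fun x hx => by rw [ha x hx, norm_zero]
  have hassoc := convolution_assoc (f := rlKernel β) (g := rlKernel γ) (k := v)
    (μ := volume) (ν := volume) L L L L (fun x y z => by simp [L, mul_assoc]) (x₀ := x)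
    (measurable_rlKernel β).aestronglyMeasurable (measurable_rlKernel γ).aestronglyMeasurable
    hv.aestronglyMeasurable ?_ ?_ ?_
  · have hk : (rlKernel β ⋆[L, volume] rlKernel γ) = rlKernel (β + γ) := by
      ext t
      rw [hconv]
      exact integral_rlKernel_mul_rlKernel hβ hγ t
    rw [hk] at hassoc
    exact hassoc.symm
  · refine Eventually.of_forall fun t => ?_
    rw [ConvolutionExistsAt]
    change Integrable (fun y => rlKernel β y * rlKernel γ (t - y)) volume
    rcases le_or_gt t 0 with ht | ht
    · have : (fun y => rlKernel β y * rlKernel γ (t - y)) = 0 := by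
        ext y
        rcases le_or_gt y 0 with h | h
        · simp [rlKernel_of_nonpos _ h]
        · simp [rlKernel_of_nonpos γ (show t - y ≤ 0 by linarith)]
      rw [this]; exact integrable_zero _ _ _
    -- The Bochner integral of a nonintegrable function is 0, whereas the value already computed is
    -- positive.
    · refine Integrable.of_integral_ne_zero ?_
      rw [integral_rlKernel_mul_rlKernel hβ hγ, rlKernel_of_pos _ ht]
      have := Real.Gamma_pos_of_pos (add_pos hβ hγ)
      positivity
  · refine Eventually.of_forall fun t => ?_
    rw [hn γ hγ]
    exact integrable_rlKernel_mul hγ hv.norm hva t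
  · rw [hn β hβ, hn γ hγ]
    exact integrable_rlKernel_mul hβ (continuous_fracInt hγ hv.norm hva)
      (fracInt_eq_zero hva) x

theorem setIntegral_Iic_eq_intervalIntegral {w : ℝ → ℝ} {a : ℝ} (ha : ∀ s ≤ a, w s = 0) {x : ℝ}
    (hx : a ≤ x) : ∫ s in Iic x, w s = ∫ s in a..x, w s := by
  rw [intervalIntegral.integral_of_le hx]
  refine setIntegral_eq_of_subset_of_forall_sdiff_eq_zero measurableSet_Iic
    (fun s hs => hs.2) fun s hs => ha s ?_
  by_contra hc
  exact hs.2 ⟨not_le.1 hc, hs.1⟩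

theorem fracInt_one {v : ℝ → ℝ} {a : ℝ} (ha : ∀ x ≤ a, v x = 0) (x : ℝ) :
    fracInt 1 v x = ∫ s in a..x, v s := by
  rcases le_total x a with h | h
  · rw [fracInt_eq_zero ha x h, intervalIntegral.integral_zero_ae]
    refine Eventually.of_forall fun s hs => ha s ?_
    rw [uIoc_of_ge h] at hs
    exact hs.2
  rw [← setIntegral_Iic_eq_intervalIntegral ha h, integral_Iic_eq_integral_Iio,
    ← integral_indicator measurableSet_Iio, fracInt, ← integral_sub_left_eq_self _ volume x]
  refine integral_congr_ae (Eventually.of_forall fun s => ?_)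
  simp only [sub_sub_cancel]
  by_cases hs : s < x
  · rw [indicator_of_mem (show s ∈ Iio x from hs), rlKernel_of_pos _ (sub_pos.2 hs)]; simp
  · rw [indicator_of_notMem (show s ∉ Iio x from hs), rlKernel_of_nonpos _ (by linarith),
      zero_mul]

theorem hasDerivAt_fracInt_one {v : ℝ → ℝ} (hv : Continuous v) {a : ℝ} (ha : ∀ x ≤ a, v x = 0)
    (x : ℝ) : HasDerivAt (fracInt 1 v) (v x) x := by
  rw [show fracInt 1 v = fun x => ∫ s in a..x, v s from funext (fracInt_one ha)]
  exact intervalIntegral.integral_hasDerivAt_right (hv.intervalIntegrable _ _)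
    hv.stronglyMeasurable.stronglyMeasurableAtFilter hv.continuousAt

theorem deriv_eq_zero_of_causal {F : ℝ → ℝ} (hF : ContDiff ℝ 1 F) {a : ℝ}
    (ha : ∀ x ≤ a, F x = 0) : ∀ x ≤ a, deriv F x = 0 := by
  have h1 : ∀ x < a, deriv F x = 0 := fun x hx => by
    have : F =ᶠ[𝓝 x] fun _ => 0 := by
      filter_upwards [Iio_mem_nhds hx] with y hy using ha y (le_of_lt hy)
    rw [this.deriv_eq, deriv_const]
  intro x hx
  have hcl : IsClosed {x | deriv F x = 0} :=
    isClosed_eq (hF.continuous_deriv le_rfl) continuous_const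
  have : closure (Iio a) ⊆ {x | deriv F x = 0} := hcl.closure_subset_iff.2 h1
  rw [closure_Iio] at this
  exact this hx

theorem fracInt_one_deriv {F : ℝ → ℝ} (hF : ContDiff ℝ 1 F) {a : ℝ} (ha : ∀ x ≤ a, F x = 0) :
    fracInt 1 (deriv F) = F := by
  ext x
  rw [fracInt_one (deriv_eq_zero_of_causal hF ha), intervalIntegral.integral_deriv_eq_sub
    (fun y _ => hF.differentiable (by norm_num) y)
    ((hF.continuous_deriv le_rfl).intervalIntegrable _ _), ha a le_rfl, sub_zero]

theorem iteratedDeriv_eq_zero_of_causal {n : ℕ} : ∀ {F : ℝ → ℝ}, ContDiff ℝ n F → ∀ {a : ℝ},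
    (∀ x ≤ a, F x = 0) → ∀ x ≤ a, iteratedDeriv n F x = 0 := by
  induction n with
  | zero => intro F _ a ha x hx; simpa using ha x hx
  | succ n ih =>
    intro F hF a ha
    rw [iteratedDeriv_succ']
    have h2 : ContDiff ℝ n (deriv F) := ContDiff.deriv' (by exact_mod_cast hF)
    exact ih h2 (deriv_eq_zero_of_causal (hF.of_le (by norm_cast; omega)) ha)

/-- Repeated fundamental theorem of calculus: causality kills every derivative up to the top one at
a, so no Taylor polynomial appears. -/
theorem fracInt_iteratedDeriv {n : ℕ} : ∀ {F : ℝ → ℝ}, ContDiff ℝ (n + 1 : ℕ) F → ∀ {a : ℝ},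
    (∀ x ≤ a, F x = 0) → fracInt (n + 1 : ℕ) (iteratedDeriv (n + 1) F) = F := by
  induction n with
  | zero =>
    intro F hF a ha
    simpa using fracInt_one_deriv (by simpa using hF) ha
  | succ n ih =>
    intro F hF a ha
    have h1 : ContDiff ℝ 1 F := hF.of_le (by norm_cast; omega)
    have h2 : ContDiff ℝ (n + 1 : ℕ) (deriv F) := ContDiff.deriv' (by exact_mod_cast hF)
    have h3 := deriv_eq_zero_of_causal h1 ha
    rw [iteratedDeriv_succ', show ((n + 1 + 1 : ℕ) : ℝ) = 1 + ((n + 1 : ℕ) : ℝ) by push_cast; ring,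
      ← fracInt_fracInt one_pos (by positivity)
        (h2.continuous_iteratedDeriv (n + 1) le_rfl) (iteratedDeriv_eq_zero_of_causal h2 h3),
      ih h2 h3, fracInt_one_deriv h1 ha]

theorem rlIntegralLine_eq_fracInt (β : ℝ) (v : ℝ → ℝ) : rlIntegralLine β v = fracInt β v := by
  ext x
  rw [rlIntegralLine, integral_Iic_eq_integral_Iio, ← integral_indicator measurableSet_Iio,
    ← integral_const_mul, fracInt, ← integral_sub_left_eq_self _ volume x]
  refine integral_congr_ae (Eventually.of_forall fun s => ?_)
  simp only
  by_cases hs : 0 < s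
  · rw [indicator_of_mem (show x - s ∈ Iio x by simpa using hs), rlKernel_of_pos _ hs,
      sub_sub_cancel, show β - 1 = -(1 - β) by ring, Real.rpow_neg hs.le]
    ring
  · rw [indicator_of_notMem (show x - s ∉ Iio x by simpa using hs),
      rlKernel_of_nonpos _ (not_lt.1 hs), zero_mul, mul_zero]

theorem rlIntegral_eq_rlIntegralLine {β a b : ℝ} {u v : ℝ → ℝ} (ha : ∀ x ≤ a, v x = 0)
    (huv : ∀ x ∈ Icc a b, v x = u x) {x : ℝ} (hx : x ∈ Icc a b) :
    rlIntegral a β u x = rlIntegralLine β v x := by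
  rw [rlIntegral, rlIntegralLine, setIntegral_Iic_eq_intervalIntegral (a := a)
    (fun s hs => by rw [ha s hs, zero_div]) hx.1]
  congr 1
  refine intervalIntegral.integral_congr fun s hs => ?_
  rw [uIcc_of_le hx.1] at hs
  rw [huv s ⟨hs.1, hs.2.trans hx.2⟩]

/-- On the interval, the second Riemann-Liouville derivative sees only the extension. -/
theorem rlDeriv_eq_iteratedDeriv {α a b : ℝ} {u v : ℝ → ℝ} (ha : ∀ x ≤ a, v x = 0)
    (huv : ∀ x ∈ Icc a b, v x = u x) {x : ℝ} (hx : x ∈ Ioo a b) :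
    rlDeriv a α u x = iteratedDeriv 2 (fracInt (2 - α) v) x := by
  rw [rlDeriv]
  refine Filter.EventuallyEq.iteratedDeriv_eq 2 ?_
  filter_upwards [isOpen_Ioo.mem_nhds hx] with y hy
  rw [rlIntegral_eq_rlIntegralLine ha huv (Ioo_subset_Icc_self hy), rlIntegralLine_eq_fracInt]

/-- A causal function is the fractional integral of its derivative of order `α + 2`. -/
theorem eq_fracInt_iteratedDeriv {α : ℝ} (h1 : 1 < α) (h2 : α < 2) {v : ℝ → ℝ}
    (hv : Continuous v) {a : ℝ} (ha : ∀ x ≤ a, v x = 0) (hF : ContDiff ℝ 4 (fracInt (2 - α) v)) :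
    v = fracInt (α + 2) (iteratedDeriv 4 (fracInt (2 - α) v)) := by
  set q := iteratedDeriv 4 (fracInt (2 - α) v) with hq
  have hF0 := fracInt_eq_zero (β := 2 - α) ha
  have hqc : Continuous q := hF.continuous_iteratedDeriv 4 le_rfl
  have hq0 : ∀ x ≤ a, q x = 0 := iteratedDeriv_eq_zero_of_causal hF hF0
  have e4 : fracInt 4 q = fracInt (2 - α) v := by
    have := fracInt_iteratedDeriv (n := 3) hF hF0
    norm_num at this
    exact this
  -- Integrating `e4` once more, to order α - 1, turns 2 - α into the integer order 1 on the side of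
  -- v. The outer `fracInt 1` can then be removed by differentiation.
  have hone : fracInt 1 v = fracInt 1 (fracInt (α + 2) q) := by
    rw [fracInt_fracInt one_pos (by linarith) hqc hq0,
      show (1 : ℝ) + (α + 2) = (α - 1) + 4 by ring,
      ← fracInt_fracInt (by linarith) (by norm_num) hqc hq0, e4,
      fracInt_fracInt (by linarith) (by linarith) hv ha]
    ring_nf
  ext x
  have hd := hasDerivAt_fracInt_one hv ha x
  rw [hone] at hd
  exact hd.unique (hasDerivAt_fracInt_one (continuous_fracInt (by linarith) hqc hq0)
    (fracInt_eq_zero hq0) x)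

theorem iteratedDeriv_two_eq_fracInt {F : ℝ → ℝ} (hF : ContDiff ℝ 4 F) {a : ℝ}
    (ha : ∀ x ≤ a, F x = 0) : iteratedDeriv 2 F = fracInt 2 (iteratedDeriv 4 F) := by
  have h2 : ContDiff ℝ (1 + 1 : ℕ) (iteratedDeriv 2 F) :=
    ContDiff.iterate_deriv' 2 2 (by norm_num; exact hF) |> fun h => by
      simpa [iteratedDeriv_eq_iterate] using! h
  have := fracInt_iteratedDeriv h2
    (iteratedDeriv_eq_zero_of_causal (hF.of_le (by norm_num)) ha)
  rw [← this]
  norm_num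
  congr 1
  simp [iteratedDeriv_eq_iterate]

end OSFDE

/-! ### Generating function of the weights and expansion of the symbol -/

namespace OSFDE

open Filter Topology Asymptotics Complex

theorem grunwald_eq_choose (α : ℝ) (k : ℕ) :
    (grunwald α k : ℂ) = (-1) ^ k * Ring.choose (α : ℂ) k := by
  induction k with
  | zero => simp [grunwald]
  | succ k ih =>
    have h : Ring.choose (α : ℂ) (k + 1) = Ring.choose (α : ℂ) k * (α - k) / (k + 1) := by
      rw [Ring.choose_eq_smul, Ring.choose_eq_smul, descPochhammer_succ_right,
        Polynomial.smeval_mul, Polynomial.smeval_sub, Polynomial.smeval_X,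
        Polynomial.smeval_natCast, Nat.factorial_succ]
      have h1 : (k : ℂ) + 1 ≠ 0 := by exact_mod_cast k.succ_ne_zero
      have h2 : (k.factorial : ℂ) ≠ 0 := by exact_mod_cast k.factorial_ne_zero
      simp only [smul_eq_mul, pow_one, pow_zero, nsmul_eq_mul, mul_one]
      push_cast
      field_simp
    have h1 : (k : ℂ) + 1 ≠ 0 := by exact_mod_cast k.succ_ne_zero
    rw [h, grunwald]
    push_cast
    rw [ih]
    field_simp
    ring

theorem hasSum_grunwald (α : ℝ) {ζ : ℂ} (hζ : ‖ζ‖ < 1) :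
    HasSum (fun k => (grunwald α k : ℂ) * ζ ^ k) ((1 - ζ) ^ (α : ℂ)) := by
  have h := (Complex.one_add_cpow_hasFPowerSeriesOnBall_zero (a := α)).hasSum (y := -ζ)
    (by
      rw [← ENNReal.ofReal_one, Metric.eball_ofReal]
      simpa using hζ)
  rw [zero_add, ← sub_eq_add_neg] at h
  convert! h using 1
  ext k
  rw [binomialSeries_apply, grunwald_eq_choose, List.ofFn_const, List.prod_replicate,
    neg_pow ζ, smul_eq_mul]
  ring

/-- The factor ζ shifts the index by one and so accounts for the coefficient of index k - 1 in the
weight. -/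
theorem hasSum_weight (α : ℝ) {ζ : ℂ} (hζ : ‖ζ‖ < 1) :
    HasSum (fun k => (weight α k : ℂ) * ζ ^ k)
      ((1 - ζ) ^ (α : ℂ) * (α / 2 + (2 - α) / 2 * ζ)) := by
  have h := hasSum_grunwald α hζ
  have h1 := h.mul_left ((α : ℂ) / 2)
  have h2 := h.mul_left ((2 - (α : ℂ)) / 2 * ζ)
  rw [← hasSum_nat_add_iff' 1] at h1 ⊢
  convert! h1.add h2 using 1
  · ext k
    simp only [weight]
    push_cast
    ring
  · simp [weight]
    ring

/-- The symbol of the weighted and shifted Grünwald operator. -/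
noncomputable def symbol (α : ℝ) (z : ℂ) : ℂ :=
  exp z * (1 - exp (-z)) ^ (α : ℂ) * (α / 2 + (2 - α) / 2 * exp (-z))

theorem hasSum_symbol (α : ℝ) {z : ℂ} (hz : 0 < z.re) :
    HasSum (fun k : ℕ => (weight α k : ℂ) * exp (-(((k : ℂ) - 1) * z))) (symbol α z) := by
  have hn : ‖exp (-z)‖ < 1 := by rw [norm_exp]; simpa using hz
  have h := (hasSum_weight α hn).mul_left (exp z)
  convert! h using 1
  · ext k
    rw [← exp_nat_mul, mul_left_comm, ← exp_add]
    ring_nf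
  · rw [symbol, mul_assoc]

theorem log_one_add_comp_isBigO {g : ℂ → ℂ} {c : ℂ} {l : Filter ℂ} (hl : l ≤ 𝓝 0)
    (hg : (fun z => g z - c * z) =O[l] fun z => z ^ 2) :
    (fun z => log (1 + g z) - c * z) =O[l] fun z => z ^ 2 := by
  have hz : Tendsto (fun z : ℂ => z) l (𝓝 0) := hl
  have hsq : (fun z : ℂ => z ^ 2) =O[l] fun z => z := by
    simpa [sq] using (isBigO_refl (fun z : ℂ => z) l).mul (hz.isBigO_one ℂ)
  have hgO : g =O[l] fun z => z := by
    have := (hg.trans hsq).add ((isBigO_refl (fun z : ℂ => z) l).const_mul_left c)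
    simpa using this
  have hgt : Tendsto g l (𝓝 0) := hgO.trans_tendsto hz
  have h1 : (fun z => log (1 + g z) - g z) =O[l] fun z => g z ^ 2 :=
    log_sub_self_isBigO.comp_tendsto hgt
  have h2 := (h1.trans (hgO.pow 2)).add hg
  refine h2.congr_left fun z => by ring

theorem exp_neg_isBigO (n : ℕ) : (fun z : ℂ => exp (-z) - ∑ i ∈ Finset.range n,
    (-z) ^ i / (i.factorial : ℂ)) =O[𝓝 0] fun z => z ^ n := by
  have ht : Tendsto (fun z : ℂ => -z) (𝓝 0) (𝓝 0) := by
    simpa using (continuous_neg (G := ℂ)).tendsto 0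
  have := (exp_sub_sum_range_isBigO_pow n).comp_tendsto ht
  refine this.trans (isBigO_of_le _ fun z => ?_)
  simp

/-- Away from its branch, the symbol is `z ^ α` times the exponential of a quantity of
second order. -/
theorem symbol_exponent_isBigO (α : ℝ) :
    (fun z : ℂ => z + α * log ((1 - exp (-z)) / z) + log (α / 2 + (2 - α) / 2 * exp (-z)))
      =O[𝓝[≠] 0] fun z => z ^ 2 := by
  have h1 : (fun z : ℂ => ((1 - exp (-z)) / z - 1) - (-1 / 2) * z) =O[𝓝[≠] 0] fun z => z ^ 2 := by
    have h := ((exp_neg_isBigO 3).mono nhdsWithin_le_nhds).mul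
      (isBigO_refl (fun z : ℂ => z⁻¹) (𝓝[≠] 0))
    have hne : ∀ᶠ z : ℂ in 𝓝[≠] 0, z ≠ 0 := eventually_mem_nhdsWithin
    refine (h.neg_left).congr' ?_ ?_
    · filter_upwards [hne] with z hz
      simp [Finset.sum_range_succ, Nat.factorial]
      field_simp
      ring
    · filter_upwards [hne] with z hz
      field_simp
  have h2 : (fun z : ℂ => (α / 2 + (2 - α) / 2 * exp (-z) - 1) - (-((2 - α) / 2)) * z)
      =O[𝓝[≠] 0] fun z => z ^ 2 := by
    have h := ((exp_neg_isBigO 2).mono (nhdsWithin_le_nhds (s := {0}ᶜ))).const_mul_left ((2 - (α : ℂ)) / 2)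
    refine h.congr_left fun z => ?_
    simp [Finset.sum_range_succ]
    ring
  have h3 := log_one_add_comp_isBigO nhdsWithin_le_nhds h1
  have h4 := log_one_add_comp_isBigO nhdsWithin_le_nhds h2
  -- The linear terms cancel because 1 - α/2 - (2 - α)/2 = 0: this is where the choice of the
  -- weights yields second order.
  refine ((h3.const_mul_left (α : ℂ)).add h4).congr_left fun z => ?_
  rw [add_sub_cancel, add_sub_cancel]
  ring

/-- Near 0 the symbol is z^α e^{L(z)} with L(z) = O(z²), and |e^L - 1| ≤ 2|L| for |L| ≤ 1. -/
theorem exists_symbol_sub_le_near_zero (α : ℝ) : ∃ δ > 0, ∃ C, 0 ≤ C ∧ ∀ z : ℂ, 0 < z.re → ‖z‖ < δ →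
    ‖symbol α z - z ^ (α : ℂ)‖ ≤ C * ‖z‖ ^ (α + 2) := by
  have hL := symbol_exponent_isBigO α
  set L : ℂ → ℂ := fun z => z + α * log ((1 - exp (-z)) / z) +
    log (α / 2 + (2 - α) / 2 * exp (-z)) with hLdef
  have hLt : Tendsto L (𝓝[≠] 0) (𝓝 0) := by
    refine hL.trans_tendsto ?_
    have : Tendsto (fun z : ℂ => z ^ 2) (𝓝 0) (𝓝 0) := by
      simpa using (continuous_pow (M := ℂ) 2).tendsto 0
    exact this.mono_left nhdsWithin_le_nhds
  obtain ⟨C, hC0, hC⟩ := hL.exists_nonneg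
  have hψ : Tendsto (fun z : ℂ => (1 - exp (-z)) / z) (𝓝[≠] 0) (𝓝 1) := by
    have hd : HasDerivAt (fun z : ℂ => -exp (-z)) 1 0 := by
      simpa using! ((hasDerivAt_neg (0 : ℂ)).cexp).neg
    have := hd.tendsto_slope_zero
    refine this.congr fun z => ?_
    simp only [zero_add, neg_zero, exp_zero, smul_eq_mul, div_eq_inv_mul]
    ring
  have hχ : Tendsto (fun z : ℂ => (α / 2 + (2 - α) / 2 * exp (-z) : ℂ)) (𝓝[≠] 0) (𝓝 1) := by
    have : Continuous fun z : ℂ => (α / 2 + (2 - α) / 2 * exp (-z) : ℂ) := by fun_prop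
    have h := this.tendsto 0
    simp only [neg_zero, exp_zero, mul_one] at h
    rw [show (α / 2 + (2 - α) / 2 : ℂ) = 1 by ring] at h
    exact h.mono_left nhdsWithin_le_nhds
  have hre : ∀ᶠ w : ℂ in 𝓝 1, 0 < w.re :=
    (isOpen_lt continuous_const continuous_re).mem_nhds (by simp)
  have hsmall : ∀ᶠ w : ℂ in 𝓝 0, ‖w‖ ≤ 1 := by
    filter_upwards [Metric.closedBall_mem_nhds (0 : ℂ) one_pos] with w hw using by simpa using hw
  have hev := (hψ.eventually hre).and ((hχ.eventually hre).and
    ((hLt.eventually hsmall).and hC.bound))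
  rw [eventually_nhdsWithin_iff, Metric.eventually_nhds_iff] at hev
  obtain ⟨δ, hδ, hev⟩ := hev
  refine ⟨δ, hδ, 2 * C, by positivity, fun z hz hzδ => ?_⟩
  have hz0 : z ≠ 0 := by rintro rfl; simp at hz
  obtain ⟨hψz, hχz, hLz, hCz⟩ := hev (by simpa using hzδ) hz0
  set ψ := (1 - exp (-z)) / z with hψdef
  set χ := (α / 2 + (2 - α) / 2 * exp (-z) : ℂ) with hχdef
  have hψ0 : ψ ≠ 0 := by intro h; rw [h] at hψz; simp at hψz
  have hχ0 : χ ≠ 0 := by intro h; rw [h] at hχz; simp at hχz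
  have hmul : 1 - exp (-z) = z * ψ := by rw [hψdef]; field_simp
  -- Both z and ψ lie in the right half-plane, so their arguments add without leaving (-π, π] and
  -- the principal logarithm of z ψ splits.
  have ha1 := abs_lt.1 (abs_arg_lt_pi_div_two_iff.2 (Or.inl hz))
  have ha2 := abs_lt.1 (abs_arg_lt_pi_div_two_iff.2 (Or.inl hψz))
  have hsym : symbol α z = z ^ (α : ℂ) * exp (L z) := by
    rw [symbol, hmul, cpow_def_of_ne_zero (mul_ne_zero hz0 hψ0), cpow_def_of_ne_zero hz0,
      log_mul hz0 hψ0 ⟨by linarith, by linarith⟩, ← hχdef]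
    have : χ = exp (log χ) := (exp_log hχ0).symm
    nth_rewrite 1 [this]
    rw [← exp_add, ← exp_add, ← exp_add]
    congr 1
    simp only [hLdef, ← hψdef, ← hχdef]
    ring
  rw [hsym, ← mul_sub_one, norm_mul, norm_cpow_real, Real.rpow_add (norm_pos_iff.2 hz0)]
  have h1 := norm_exp_sub_one_le hLz
  rw [norm_pow] at hCz
  have h2 : (0 : ℝ) ≤ ‖z‖ ^ α := Real.rpow_nonneg (norm_nonneg _) _
  calc ‖z‖ ^ α * ‖exp (L z) - 1‖ ≤ ‖z‖ ^ α * (2 * (C * ‖z‖ ^ 2)) := by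
        gcongr; linarith
    _ = 2 * C * (‖z‖ ^ α * ‖z‖ ^ (2 : ℝ)) := by
        rw [Real.rpow_two]; ring

/-- The cap Re z ≤ 1 is needed only for the shift factor e^z; the last factor is at most 1 because
α/2 and (2 - α)/2 are nonnegative and add up to 1. -/
theorem norm_symbol_le {α : ℝ} (h1 : 1 < α) (h2 : α < 2) {z : ℂ} (hz : 0 < z.re)
    (hz1 : z.re ≤ 1) : ‖symbol α z‖ ≤ Real.exp 1 * 2 ^ α := by
  have hn : ‖exp (-z)‖ ≤ 1 := by rw [norm_exp]; simpa using hz.le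
  have e1 : ‖exp z‖ ≤ Real.exp 1 := by rw [norm_exp]; exact Real.exp_le_exp.2 hz1
  have e2 : ‖(1 - exp (-z)) ^ (α : ℂ)‖ ≤ 2 ^ α := by
    rw [norm_cpow_real]
    refine Real.rpow_le_rpow (norm_nonneg _) ?_ (by linarith)
    refine (norm_sub_le _ _).trans ?_
    rw [norm_one]; linarith
  have e3 : ‖(α / 2 + (2 - α) / 2 * exp (-z) : ℂ)‖ ≤ 1 := by
    refine (norm_add_le _ _).trans ?_
    have a1 : ‖(α / 2 : ℂ)‖ = α / 2 := by
      rw [← ofReal_ofNat, ← ofReal_div, norm_real, Real.norm_of_nonneg (by linarith)]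
    have a2 : ‖((2 - α) / 2 : ℂ)‖ = (2 - α) / 2 := by
      rw [← ofReal_ofNat, ← ofReal_sub, ← ofReal_div, norm_real,
        Real.norm_of_nonneg (by linarith)]
    rw [norm_mul, a1, a2]
    nlinarith
  rw [symbol, norm_mul, norm_mul]
  calc _ ≤ Real.exp 1 * 2 ^ α * 1 := by gcongr
    _ = _ := mul_one _

/-- The symbol agrees with `z ^ α` to second order. -/
theorem exists_symbol_sub_le {α : ℝ} (h1 : 1 < α) (h2 : α < 2) : ∃ C, 0 ≤ C ∧ ∀ z : ℂ,
    0 < z.re → z.re ≤ 1 → ‖symbol α z - z ^ (α : ℂ)‖ ≤ C * ‖z‖ ^ (α + 2) := by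
  obtain ⟨δ, hδ, C, hC0, hC⟩ := exists_symbol_sub_le_near_zero α
  refine ⟨C + (Real.exp 1 * 2 ^ α / δ ^ (α + 2) + 1 / δ ^ (2 : ℝ)), by positivity,
    fun z hz hz1 => ?_⟩
  rw [add_mul]
  -- For ‖z‖ ≥ δ no cancellation is needed: constants are at most multiples of (‖z‖/δ)^(α+2), and
  -- ‖z‖^α ≤ ‖z‖^(α+2)/δ².
  rcases lt_or_ge ‖z‖ δ with h | h
  · refine (hC z hz h).trans (le_add_of_nonneg_right (by positivity))
  · refine le_trans ?_ (le_add_of_nonneg_left (by positivity))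
    have hzp : 0 < ‖z‖ := hδ.trans_le h
    refine (norm_sub_le _ _).trans ?_
    rw [add_mul, norm_cpow_real]
    refine add_le_add ((norm_symbol_le h1 h2 hz hz1).trans ?_) ?_
    · rw [div_mul_eq_mul_div, le_div_iff₀ (by positivity)]
      gcongr
    · rw [one_div_mul_eq_div, le_div_iff₀ (by positivity), Real.rpow_add hzp]
      gcongr

end OSFDE

/-! ### Laplace transform of the kernel and damped fractional integrals -/

namespace OSFDE

open MeasureTheory Set Filter Topology

theorem integrable_rlKernel_mul_exp {β σ : ℝ} (hβ : 0 < β) (hσ : 0 < σ) :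
    Integrable fun y => rlKernel β y * Real.exp (-(σ * y)) := by
  have h := (integrableOn_rpow_mul_exp_neg_mul_rpow (p := 1) (s := β - 1) (b := σ)
    (by linarith) one_pos hσ).div_const (Real.Gamma β)
  refine ((integrable_indicator_iff measurableSet_Ioi).2 h).congr (Eventually.of_forall fun y => ?_)
  by_cases hy : 0 < y
  · simp only [indicator_of_mem (show y ∈ Ioi 0 from hy), rlKernel_of_pos _ hy, Real.rpow_one,
      neg_mul]
    ring
  · simp [indicator_of_notMem (show y ∉ Ioi 0 from hy), rlKernel_of_nonpos _ (not_lt.1 hy)]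

theorem norm_rlKernel_mul_cexp {β : ℝ} (hβ : 0 < β) (z : ℂ) (y : ℝ) :
    ‖(rlKernel β y : ℂ) * Complex.exp (-(z * y))‖ = rlKernel β y * Real.exp (-(z.re * y)) := by
  rw [norm_mul, Complex.norm_real, Real.norm_of_nonneg (rlKernel_nonneg hβ y), Complex.norm_exp]
  simp

theorem measurable_rlKernel_mul_cexp (β : ℝ) (z : ℂ) :
    Measurable fun y : ℝ => (rlKernel β y : ℂ) * Complex.exp (-(z * y)) :=
  (Complex.measurable_ofReal.comp (measurable_rlKernel β)).mul (by fun_prop)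

theorem integrable_rlKernel_mul_cexp {β : ℝ} {z : ℂ} (hβ : 0 < β) (hz : 0 < z.re) :
    Integrable fun y : ℝ => (rlKernel β y : ℂ) * Complex.exp (-(z * y)) := by
  refine (integrable_rlKernel_mul_exp hβ hz).mono'
    (measurable_rlKernel_mul_cexp β z).aestronglyMeasurable (Eventually.of_forall fun y => ?_)
  rw [norm_rlKernel_mul_cexp hβ]

theorem rlKernel_mul_self {β : ℝ} (hβ : 0 < β) (y : ℝ) :
    rlKernel β y * y = β * rlKernel (β + 1) y := by
  rcases le_or_gt y 0 with hy | hy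
  · simp [rlKernel_of_nonpos _ hy]
  · rw [rlKernel_of_pos _ hy, rlKernel_of_pos _ hy, Real.Gamma_add_one hβ.ne',
      add_sub_cancel_right, div_mul_eq_mul_div, ← Real.rpow_add_one hy.ne', sub_add_cancel]
    field_simp

/-- Differentiation under the integral brings down a factor -y, which raises the order of the kernel
to β + 1; on Re z > Re z₀ / 2 a single exponential dominates. -/
theorem differentiableOn_integral_rlKernel_mul_cexp {β : ℝ} (hβ : 0 < β) :
    DifferentiableOn ℂ (fun z : ℂ => ∫ y : ℝ, (rlKernel β y : ℂ) * Complex.exp (-(z * y)))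
      {z | 0 < z.re} := by
  intro z₀ (hz₀ : 0 < z₀.re)
  have hs : {z : ℂ | z₀.re / 2 < z.re} ∈ 𝓝 z₀ :=
    (isOpen_lt continuous_const Complex.continuous_re).mem_nhds (by simp; linarith)
  have h := hasDerivAt_integral_of_dominated_loc_of_deriv_le (μ := volume)
    (F := fun (z : ℂ) (y : ℝ) => (rlKernel β y : ℂ) * Complex.exp (-(z * y)))
    (F' := fun (z : ℂ) (y : ℝ) => (rlKernel β y : ℂ) * (Complex.exp (-(z * y)) * -y))
    (bound := fun y => β * (rlKernel (β + 1) y * Real.exp (-(z₀.re / 2 * y)))) hs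
    (Eventually.of_forall fun z => (measurable_rlKernel_mul_cexp β z).aestronglyMeasurable)
    (integrable_rlKernel_mul_cexp hβ hz₀) ?_ ?_ ?_ ?_
  · exact h.2.differentiableAt.differentiableWithinAt
  · exact ((Complex.measurable_ofReal.comp (measurable_rlKernel β)).mul
      (by fun_prop)).aestronglyMeasurable
  · refine Eventually.of_forall fun y z (hz : z₀.re / 2 < z.re) => ?_
    rw [← mul_assoc, norm_mul, norm_rlKernel_mul_cexp hβ, norm_neg, Complex.norm_real,
      ← mul_assoc, ← rlKernel_mul_self hβ]
    rcases le_or_gt y 0 with hy | hy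
    · simp [rlKernel_of_nonpos _ hy]
    · rw [Real.norm_of_nonneg hy.le, mul_right_comm]
      have := rlKernel_nonneg hβ y
      gcongr
  · exact (integrable_rlKernel_mul_exp (by linarith) (by linarith)).const_mul _
  · refine Eventually.of_forall fun y z _ => ?_
    have h1 : HasDerivAt (fun z : ℂ => -(z * y)) (-(y : ℂ)) z := by
      simpa using! ((hasDerivAt_id z).mul_const (y : ℂ)).neg
    exact h1.cexp.const_mul _

/-- The Laplace transform of the kernel of the fractional integral. -/
theorem integral_rlKernel_mul_cexp {β : ℝ} (hβ : 0 < β) {z : ℂ} (hz : 0 < z.re) :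
    ∫ y : ℝ, (rlKernel β y : ℂ) * Complex.exp (-(z * y)) = z ^ (-β : ℂ) := by
  have hopen : IsOpen {z : ℂ | 0 < z.re} := isOpen_lt continuous_const Complex.continuous_re
  have hconv : IsPreconnected {z : ℂ | 0 < z.re} :=
    (convex_halfSpace_re_gt 0).isPreconnected
  have hreal : ∀ r : ℝ, 0 < r →
      ∫ y : ℝ, (rlKernel β y : ℂ) * Complex.exp (-((r : ℂ) * y)) = (r : ℂ) ^ (-β : ℂ) := by
    intro r hr
    have hG := (Real.Gamma_pos_of_pos hβ).ne'
    have h1 : ∫ y : ℝ, rlKernel β y * Real.exp (-(r * y)) = r ^ (-β) := by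
      have h := Real.integral_rpow_mul_exp_neg_mul_Ioi hβ hr
      have : (fun y => rlKernel β y * Real.exp (-(r * y))) = indicator (Ioi 0)
          fun y => y ^ (β - 1) * Real.exp (-(r * y)) / Real.Gamma β := by
        ext y
        by_cases hy : y ∈ Ioi 0
        · rw [indicator_of_mem hy, rlKernel_of_pos _ hy]; ring
        · rw [indicator_of_notMem hy, rlKernel_of_nonpos _ (not_lt.1 hy), zero_mul]
      rw [this, integral_indicator measurableSet_Ioi, integral_div, h, Real.rpow_neg hr.le,
        one_div, Real.inv_rpow hr.le, mul_div_assoc, div_self hG, mul_one]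
    rw [← Complex.ofReal_neg, ← Complex.ofReal_cpow hr.le, ← h1, ← integral_complex_ofReal]
    congr 1
    ext y
    push_cast
    rfl
  have han : AnalyticOnNhd ℂ (fun z : ℂ => z ^ (-β : ℂ)) {z | 0 < z.re} := by
    refine DifferentiableOn.analyticOnNhd (fun w (hw : 0 < w.re) => ?_) hopen
    exact (differentiableAt_id.cpow_const (Or.inl hw)).differentiableWithinAt
  -- Identity theorem on the right half-plane: both sides are analytic and agree at the positive
  -- reals, which accumulate at 1.
  refine ((differentiableOn_integral_rlKernel_mul_cexp hβ).analyticOnNhd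
    hopen).eqOn_of_preconnected_of_frequently_eq han hconv (z₀ := ((1 : ℝ) : ℂ)) (by simp) ?_ hz
  have ht : Tendsto (fun t : ℝ => (t : ℂ)) (𝓝[≠] 1) (𝓝[≠] ((1 : ℝ) : ℂ)) := by
    refine tendsto_nhdsWithin_of_tendsto_nhds_of_eventually_within _
      ((Complex.continuous_ofReal.tendsto 1).mono_left nhdsWithin_le_nhds) ?_
    filter_upwards [eventually_mem_nhdsWithin] with t ht
    simpa using ht
  refine ht.frequently (Eventually.frequently ?_)
  filter_upwards [nhdsWithin_le_nhds (Ioi_mem_nhds (zero_lt_one (α := ℝ)))] with t htpos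
  exact hreal t htpos

/-- The fractional integral with an exponentially damped kernel. -/
noncomputable def dampedInt (β σ : ℝ) (q : ℝ → ℝ) (x : ℝ) : ℝ :=
  ∫ y, rlKernel β y * Real.exp (-(σ * y)) * q (x - y)

theorem dampedInt_eq_zero {β σ : ℝ} {q : ℝ → ℝ} {a : ℝ} (ha : ∀ x ≤ a, q x = 0) :
    ∀ x ≤ a, dampedInt β σ q x = 0 := by
  intro x hx
  refine integral_eq_zero_of_ae (Eventually.of_forall fun y => ?_)
  rcases le_or_gt y 0 with hy | hy
  · simp [rlKernel_of_nonpos _ hy]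
  · simp [ha (x - y) (by linarith)]

/-- Dominated convergence: for σ > 0 the undamped integrand is a majorant, integrable because q is
causal. -/
theorem tendsto_dampedInt {β : ℝ} (hβ : 0 < β) {q : ℝ → ℝ} (hq : Continuous q) {a : ℝ}
    (ha : ∀ x ≤ a, q x = 0) (x : ℝ) :
    Tendsto (fun σ => dampedInt β σ q x) (𝓝[>] 0) (𝓝 (fracInt β q x)) := by
  refine tendsto_integral_filter_of_dominated_convergence
    (fun y => ‖rlKernel β y * q (x - y)‖) (Eventually.of_forall fun σ => ?_) ?_
    (integrable_rlKernel_mul hβ hq ha x).norm (Eventually.of_forall fun y => ?_)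
  · exact (((measurable_rlKernel β).mul (by fun_prop)).mul
      (hq.measurable.comp (by fun_prop))).aestronglyMeasurable
  · filter_upwards [self_mem_nhdsWithin] with σ (hσ : 0 < σ)
    refine Eventually.of_forall fun y => ?_
    rcases le_or_gt y 0 with hy | hy
    · simp [rlKernel_of_nonpos _ hy]
    · rw [mul_right_comm, norm_mul]
      refine mul_le_of_le_one_right (norm_nonneg _) ?_
      rw [Real.norm_of_nonneg (Real.exp_pos _).le, Real.exp_le_one_iff]
      nlinarith
  · have : Continuous fun σ : ℝ => rlKernel β y * Real.exp (-(σ * y)) * q (x - y) := by fun_prop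
    have h := this.tendsto 0
    simp only [zero_mul, neg_zero, Real.exp_zero, mul_one] at h
    exact h.mono_left nhdsWithin_le_nhds

/-- The point `σ + 2πiξ` of the vertical line with abscissa `σ`. -/
noncomputable def lineZ (σ ξ : ℝ) : ℂ := σ + 2 * Real.pi * ξ * Complex.I

@[simp] theorem lineZ_re (σ ξ : ℝ) : (lineZ σ ξ).re = σ := by simp [lineZ]

theorem continuous_lineZ (σ : ℝ) : Continuous (lineZ σ) := by
  unfold lineZ; fun_prop

/-- This is the exchange formula ∫ k̂ g = ∫ k ĝ for the damped kernel k and g(ξ) = q̂(ξ) e^{2πixξ}.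
Here k̂ is the Laplace transform on the line Re z = σ, and ĝ(y) = q(x - y) by Fourier inversion.
Damping is what makes k integrable. -/
theorem dampedInt_eq_integral_fourier {β σ : ℝ} (hβ : 0 < β) (hσ : 0 < σ) {q : ℝ → ℝ}
    (hq : Continuous q) (hqi : Integrable q) (hQ : Integrable (𝓕 fun x : ℝ => (q x : ℂ))) (x : ℝ) :
    (dampedInt β σ q x : ℂ) = ∫ ξ : ℝ, (𝓕 fun x : ℝ => (q x : ℂ)) ξ *
      Complex.exp (2 * Real.pi * ξ * x * Complex.I) * lineZ σ ξ ^ (-β : ℂ) := by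
  set Q := 𝓕 fun x : ℝ => (q x : ℂ) with hQdef
  set g : ℝ → ℂ := fun ξ => Q ξ * Complex.exp (2 * Real.pi * ξ * x * Complex.I) with hg
  set k : ℝ → ℂ := fun y => (rlKernel β y : ℂ) * Complex.exp (-((σ : ℂ) * y)) with hk
  have hki : Integrable k := integrable_rlKernel_mul_cexp hβ (by simpa using hσ)
  have hgi : Integrable g := by
    refine hQ.mul_bdd (c := 1) (by fun_prop) (Eventually.of_forall fun ξ => ?_)
    rw [Complex.norm_exp]; simp
  have hflip := VectorFourier.integral_fourierIntegral_smul_eq_flip (L := innerₗ ℝ)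
    Real.continuous_fourierChar continuous_inner hki hgi
  have hinv : 𝓕⁻ Q = fun x => (q x : ℂ) :=
    Continuous.fourierInv_fourier_eq (by fun_prop) hqi.ofReal hQ
  have hL : ∀ ξ, VectorFourier.fourierIntegral Real.fourierChar volume (innerₗ ℝ) k ξ =
      lineZ σ ξ ^ (-β : ℂ) := by
    intro ξ
    rw [← integral_rlKernel_mul_cexp hβ (z := lineZ σ ξ) (by simpa using hσ)]
    change 𝓕 k ξ = _
    rw [Real.fourier_eq']
    congr 1
    ext y
    simp only [hk, smul_eq_mul, lineZ]
    rw [mul_left_comm, ← Complex.exp_add]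
    congr 2
    simp
    ring
  have hR : ∀ y, VectorFourier.fourierIntegral Real.fourierChar volume (innerₗ ℝ).flip g y =
      q (x - y) := by
    intro y
    rw [flip_innerₗ]
    change 𝓕 g y = _
    rw [← congrFun hinv (x - y), Real.fourier_eq', Real.fourierInv_eq']
    congr 1
    ext ξ
    simp only [hg, smul_eq_mul]
    rw [mul_left_comm, ← Complex.exp_add, mul_comm]
    congr 2
    simp
    ring
  simp only [hL, hR] at hflip
  rw [dampedInt, ← integral_complex_ofReal]
  rw [show (∫ ξ : ℝ, Q ξ * Complex.exp (2 * Real.pi * ξ * x * Complex.I) * lineZ σ ξ ^ (-β : ℂ)) =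
    ∫ ξ, lineZ σ ξ ^ (-β : ℂ) • g ξ from integral_congr_ae (Eventually.of_forall fun ξ => by
      simp only [hg, smul_eq_mul]; ring), hflip]
  congr 1
  ext y
  simp only [hk, smul_eq_mul]
  push_cast
  rfl

end OSFDE

/-! ### Second-order accuracy of the shifted Grünwald formula -/

namespace OSFDE

open MeasureTheory Set Filter Topology

theorem measurable_symbol (α : ℝ) : Measurable (symbol α) := by
  unfold symbol; fun_prop

theorem le_norm_lineZ {σ : ℝ} (hσ : 0 < σ) (ξ : ℝ) : σ ≤ ‖lineZ σ ξ‖ := by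
  have := Complex.abs_re_le_norm (lineZ σ ξ)
  rwa [lineZ_re, abs_of_pos hσ] at this

theorem norm_lineZ_cpow_neg_le {β σ : ℝ} (hβ : 0 < β) (hσ : 0 < σ) (ξ : ℝ) :
    ‖lineZ σ ξ ^ (-β : ℂ)‖ ≤ σ ^ (-β) := by
  rw [← Complex.ofReal_neg, Complex.norm_cpow_real]
  exact Real.rpow_le_rpow_of_nonpos hσ (le_norm_lineZ hσ ξ) (by linarith)

theorem norm_cexp_two_pi_mul (ξ x : ℝ) :
    ‖Complex.exp (2 * Real.pi * ξ * x * Complex.I)‖ = 1 := by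
  rw [Complex.norm_exp]; simp

/-- The damped Grünwald sum in terms of the Fourier transform and the symbol. -/
theorem hasSum_weight_mul_dampedInt {α β σ h : ℝ} (hβ : 0 < β) (hσ : 0 < σ) (hh : 0 < h)
    {q : ℝ → ℝ} (hq : Continuous q) (hqi : Integrable q)
    (hQ : Integrable (𝓕 fun x : ℝ => (q x : ℂ))) (x : ℝ) :
    HasSum (fun k : ℕ => ((weight α k * Real.exp (-(((k : ℝ) - 1) * (h * σ))) *
        dampedInt β σ q (x - ((k : ℝ) - 1) * h) : ℝ) : ℂ))
      (∫ ξ : ℝ, (𝓕 fun x : ℝ => (q x : ℂ)) ξ * Complex.exp (2 * Real.pi * ξ * x * Complex.I) *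
        lineZ σ ξ ^ (-β : ℂ) * symbol α (h * lineZ σ ξ)) := by
  set Q := 𝓕 fun x : ℝ => (q x : ℂ) with hQdef
  have hre : ∀ ξ, 0 < ((h : ℂ) * lineZ σ ξ).re := fun ξ => by
    rw [Complex.re_ofReal_mul, lineZ_re]; positivity
  set F : ℕ → ℝ → ℂ := fun k ξ => Q ξ * Complex.exp (2 * Real.pi * ξ * x * Complex.I) *
    lineZ σ ξ ^ (-β : ℂ) *
      ((weight α k : ℂ) * Complex.exp (-(((k : ℂ) - 1) * (h * lineZ σ ξ)))) with hF
  have hlm := (continuous_lineZ σ).measurable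
  have hbase : Integrable fun ξ : ℝ => Q ξ * Complex.exp (2 * Real.pi * ξ * x * Complex.I) *
      lineZ σ ξ ^ (-β : ℂ) := by
    refine Integrable.mul_bdd (c := σ ^ (-β)) (hQ.mul_bdd (c := 1) (by fun_prop)
      (Eventually.of_forall fun ξ => (norm_cexp_two_pi_mul ξ x).le))
      (hlm.pow_const _).aestronglyMeasurable
      (Eventually.of_forall fun ξ => norm_lineZ_cpow_neg_le hβ hσ ξ)
  -- On the vertical line this modulus does not depend on ξ, so the norm of each summand integrates
  -- to a product and summability reduces to the symbol series at hσ.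
  have hnexp : ∀ (k : ℕ) ξ, ‖(weight α k : ℂ) * Complex.exp (-(((k : ℂ) - 1) * (h * lineZ σ ξ)))‖ =
      ‖(weight α k : ℂ) * Complex.exp (-(((k : ℂ) - 1) * ((h * σ : ℝ) : ℂ)))‖ := by
    intro k ξ
    rw [norm_mul, norm_mul, Complex.norm_exp, Complex.norm_exp]
    congr 2
    rw [show (k : ℂ) - 1 = (((k : ℝ) - 1 : ℝ) : ℂ) by push_cast; ring, Complex.neg_re,
      Complex.neg_re, Complex.re_ofReal_mul, Complex.re_ofReal_mul, Complex.re_ofReal_mul,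
      lineZ_re, Complex.ofReal_re]
  have hFi : ∀ k, Integrable (F k) := fun k => by
    refine hbase.mul_bdd (c := ‖(weight α k : ℂ) *
      Complex.exp (-(((k : ℂ) - 1) * ((h * σ : ℝ) : ℂ)))‖) ?_
      (Eventually.of_forall fun ξ => (hnexp k ξ).le)
    exact Measurable.aestronglyMeasurable (by fun_prop)
  have hsum : Summable fun k => ∫ ξ, ‖F k ξ‖ := by
    have hs := (hasSum_symbol α (z := ((h * σ : ℝ) : ℂ))
      (by rw [Complex.ofReal_re]; positivity)).summable.norm
    refine (hs.mul_left (∫ ξ : ℝ, ‖Q ξ * Complex.exp (2 * Real.pi * ξ * x * Complex.I) *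
      lineZ σ ξ ^ (-β : ℂ)‖)).congr fun k => ?_
    rw [← integral_mul_const]
    refine integral_congr_ae (Eventually.of_forall fun ξ => ?_)
    simp only [hF]
    rw [norm_mul _ ((weight α k : ℂ) * _), hnexp]
  have key := hasSum_integral_of_summable_integral_norm hFi hsum
  convert! key using 1
  · ext k
    push_cast
    rw [dampedInt_eq_integral_fourier hβ hσ hq hqi hQ, ← integral_const_mul]
    congr 1
    ext ξ
    simp only [hF, ← hQdef, lineZ]
    have : Complex.exp (-(((k : ℂ) - 1) * (h * (σ + 2 * Real.pi * ξ * Complex.I)))) *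
        Complex.exp (2 * Real.pi * ξ * x * Complex.I) =
        Complex.exp (-(((k : ℂ) - 1) * (h * σ))) *
        Complex.exp (2 * Real.pi * ξ * ((x - ((k : ℝ) - 1) * h : ℝ) : ℂ) * Complex.I) := by
      rw [← Complex.exp_add, ← Complex.exp_add]
      congr 1
      push_cast
      ring
    linear_combination -(Q ξ * (σ + 2 * Real.pi * ξ * Complex.I) ^ (-β : ℂ) * weight α k) * this
  · refine integral_congr_ae (Eventually.of_forall fun ξ => ?_)
    exact ((hasSum_symbol α (hre ξ)).mul_left _).tsum_eq.symm

/-- Since z^{-2} = z^{-(α+2)} z^α, the difference is h^{-α} z^{-(α+2)} (symbol(hz) - (hz)^α). The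
power of ‖z‖ cancels and h² is left, uniformly in ξ and σ. -/
theorem norm_symbol_error_le {α C h σ : ℝ} (hh : 0 < h) (hσ : 0 < σ) (hhσ : h * σ ≤ 1)
    (hC : ∀ z : ℂ, 0 < z.re → z.re ≤ 1 → ‖symbol α z - z ^ (α : ℂ)‖ ≤ C * ‖z‖ ^ (α + 2))
    (ξ : ℝ) :
    ‖(1 / h ^ α : ℝ) * (lineZ σ ξ ^ (-(α + 2 : ℝ) : ℂ) * symbol α (h * lineZ σ ξ)) -
      lineZ σ ξ ^ (-(2 : ℝ) : ℂ)‖ ≤ C * h ^ 2 := by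
  set z := lineZ σ ξ with hz
  have hzp : 0 < ‖z‖ := hσ.trans_le (le_norm_lineZ hσ ξ)
  have hz0 : z ≠ 0 := norm_pos_iff.1 hzp
  have hre : ((h : ℂ) * z).re = h * σ := by rw [Complex.re_ofReal_mul, hz, lineZ_re]
  have hmul : ((h : ℂ) * z) ^ (α : ℂ) = ((h ^ α : ℝ) : ℂ) * z ^ (α : ℂ) := by
    rw [Complex.ofReal_cpow hh.le]
    have hh0 : (h : ℂ) ≠ 0 := by exact_mod_cast hh.ne'
    rw [Complex.cpow_def_of_ne_zero (mul_ne_zero hh0 hz0), Complex.cpow_def_of_ne_zero hh0,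
      Complex.cpow_def_of_ne_zero hz0, Complex.log_ofReal_mul hh hz0, ← Complex.exp_add,
      Complex.ofReal_log hh.le]
    ring_nf
  have hha : (0 : ℝ) < h ^ α := Real.rpow_pos_of_pos hh α
  have hsplit : z ^ (-(2 : ℝ) : ℂ) = z ^ (-(α + 2 : ℝ) : ℂ) * z ^ (α : ℂ) := by
    rw [← Complex.cpow_add _ _ hz0]
    congr 1
    push_cast
    ring
  have hb := hC ((h : ℂ) * z) (by rw [hre]; positivity) (by rw [hre]; exact hhσ)
  have hne : ((h ^ α : ℝ) : ℂ) ≠ 0 := by exact_mod_cast hha.ne'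
  have he : ((1 / h ^ α : ℝ) : ℂ) * (z ^ (-(α + 2 : ℝ) : ℂ) * symbol α (h * z)) -
      z ^ (-(2 : ℝ) : ℂ) = ((1 / h ^ α : ℝ) : ℂ) * z ^ (-(α + 2 : ℝ) : ℂ) *
        (symbol α (h * z) - (h * z) ^ (α : ℂ)) := by
    rw [hsplit, hmul]
    push_cast at hne ⊢
    field_simp
  rw [he, norm_mul, norm_mul, ← Complex.ofReal_neg, Complex.norm_cpow_real, Complex.norm_real,
    Real.norm_of_nonneg (by positivity)]
  rw [norm_mul, Complex.norm_real, Real.norm_of_nonneg hh.le,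
    Real.mul_rpow hh.le hzp.le] at hb
  have hzr : (0 : ℝ) < ‖z‖ ^ (α + 2) := Real.rpow_pos_of_pos hzp _
  calc 1 / h ^ α * ‖z‖ ^ (-(α + 2)) * ‖symbol α (h * z) - (h * z) ^ (α : ℂ)‖
      ≤ 1 / h ^ α * ‖z‖ ^ (-(α + 2)) * (C * (h ^ (α + 2) * ‖z‖ ^ (α + 2))) := by gcongr
    _ = C * h ^ 2 := by
        rw [Real.rpow_neg hzp.le, Real.rpow_add hh, Real.rpow_two]
        field_simp

/-- The damped truncation error is bounded by the integral of the Fourier transform. -/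
theorem norm_damped_error_le {α C h σ : ℝ} (h1 : 1 < α) (h2 : α < 2) (hh : 0 < h) (hσ : 0 < σ)
    (hhσ : h * σ ≤ 1)
    (hC : ∀ z : ℂ, 0 < z.re → z.re ≤ 1 → ‖symbol α z - z ^ (α : ℂ)‖ ≤ C * ‖z‖ ^ (α + 2))
    {q : ℝ → ℝ} (hq : Continuous q) (hqi : Integrable q)
    (hQ : Integrable (𝓕 fun x : ℝ => (q x : ℂ))) {a : ℝ} (ha : ∀ x ≤ a, q x = 0) {x : ℝ} {n : ℕ}
    (hn : x - ((n : ℝ) - 1) * h ≤ a) :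
    |1 / h ^ α * (∑ k ∈ Finset.range n, weight α k * Real.exp (-(((k : ℝ) - 1) * (h * σ))) *
        dampedInt (α + 2) σ q (x - ((k : ℝ) - 1) * h)) - dampedInt 2 σ q x| ≤
      C * h ^ 2 * ∫ ξ : ℝ, ‖(𝓕 fun x : ℝ => (q x : ℂ)) ξ‖ := by
  set Q := 𝓕 fun x : ℝ => (q x : ℂ) with hQdef
  have hS := hasSum_weight_mul_dampedInt (α := α) (β := α + 2) (by linarith) hσ hh hq hqi hQ x
  -- For k ≥ n the evaluation point is at most a, where the damped integral vanishes by causality.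
  have hfin := hasSum_sum_of_ne_finset_zero (L := .unconditional ℕ) (s := Finset.range n)
    (f := fun k : ℕ => ((weight α k * Real.exp (-(((k : ℝ) - 1) * (h * σ))) *
        dampedInt (α + 2) σ q (x - ((k : ℝ) - 1) * h) : ℝ) : ℂ)) (fun k hk => by
      rw [Finset.mem_range, not_lt] at hk
      have hk' : (n : ℝ) ≤ k := by exact_mod_cast hk
      rw [dampedInt_eq_zero ha, mul_zero, Complex.ofReal_zero]
      nlinarith)
  have heq := hfin.unique hS
  rw [← hQdef] at heq
  have hlm := (continuous_lineZ σ).measurable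
  have hsm := measurable_symbol α
  have hbase : Integrable fun ξ : ℝ => Q ξ * Complex.exp (2 * Real.pi * ξ * x * Complex.I) :=
    hQ.mul_bdd (c := 1) (by fun_prop)
      (Eventually.of_forall fun ξ => (norm_cexp_two_pi_mul ξ x).le)
  have hi : ∀ β : ℝ, 0 < β → Integrable fun ξ : ℝ =>
      Q ξ * Complex.exp (2 * Real.pi * ξ * x * Complex.I) * lineZ σ ξ ^ (-β : ℂ) := fun β hβ =>
    hbase.mul_bdd (c := σ ^ (-β)) (hlm.pow_const _).aestronglyMeasurable
      (Eventually.of_forall fun ξ => norm_lineZ_cpow_neg_le hβ hσ ξ)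
  have hi1 : Integrable fun ξ : ℝ => Q ξ * Complex.exp (2 * Real.pi * ξ * x * Complex.I) *
      lineZ σ ξ ^ (-(α + 2 : ℝ) : ℂ) * symbol α (h * lineZ σ ξ) := by
    refine (hi (α + 2) (by linarith)).mul_bdd (c := Real.exp 1 * 2 ^ α)
      (hsm.comp (hlm.const_mul _)).aestronglyMeasurable (Eventually.of_forall fun ξ => ?_)
    refine norm_symbol_le h1 h2 ?_ ?_ <;> rw [Complex.re_ofReal_mul, lineZ_re]
    · positivity
    · exact hhσ
  rw [← Real.norm_eq_abs, ← Complex.norm_real]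
  have hrepr : ((1 / h ^ α * (∑ k ∈ Finset.range n, weight α k *
        Real.exp (-(((k : ℝ) - 1) * (h * σ))) *
        dampedInt (α + 2) σ q (x - ((k : ℝ) - 1) * h)) - dampedInt 2 σ q x : ℝ) : ℂ) =
      ∫ ξ : ℝ, Q ξ * Complex.exp (2 * Real.pi * ξ * x * Complex.I) *
        ((1 / h ^ α : ℝ) * (lineZ σ ξ ^ (-(α + 2 : ℝ) : ℂ) * symbol α (h * lineZ σ ξ)) -
          lineZ σ ξ ^ (-(2 : ℝ) : ℂ)) := by
    rw [Complex.ofReal_sub, Complex.ofReal_mul, Complex.ofReal_sum, heq,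
      dampedInt_eq_integral_fourier two_pos hσ hq hqi hQ, ← integral_const_mul,
      ← integral_sub (hi1.const_mul _) (hi 2 two_pos)]
    congr 1
    ext ξ
    ring
  rw [hrepr, ← integral_const_mul]
  refine norm_integral_le_of_norm_le (hQ.norm.const_mul _) (Eventually.of_forall fun ξ => ?_)
  rw [norm_mul, norm_mul, norm_cexp_two_pi_mul, mul_one, mul_comm]
  exact mul_le_mul_of_nonneg_right (norm_symbol_error_le hh hσ hhσ hC ξ) (norm_nonneg _)

/-- The weighted and shifted Grünwald formula is second order accurate. -/
theorem exists_grunwald_error_le {α : ℝ} (h1 : 1 < α) (h2 : α < 2) : ∃ C, 0 ≤ C ∧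
    ∀ (K : ℝ) (v : ℝ → ℝ) (a : ℝ), IsSpaceRegular α K v → (∀ x ≤ a, v x = 0) →
    ∀ (h x : ℝ) (n : ℕ), 0 < h → x - ((n : ℝ) - 1) * h ≤ a →
    |1 / h ^ α * (∑ k ∈ Finset.range n, weight α k * v (x - ((k : ℝ) - 1) * h)) -
      iteratedDeriv 2 (fracInt (2 - α) v) x| ≤ C * K * h ^ 2 := by
  obtain ⟨C, hC0, hC⟩ := exists_symbol_sub_le h1 h2
  refine ⟨C, hC0, fun K v a hv ha h x n hh hn => ?_⟩
  have hord : 4 - (α + 2) = 2 - α := by ring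
  obtain ⟨hvc, -, hF, hqi, hQ, hK⟩ := hv
  have hd : rlDerivLine (α + 2) v = iteratedDeriv 4 (fracInt (2 - α) v) := by
    ext y
    rw [rlDerivLine, rlIntegralLine_eq_fracInt, hord]
  rw [rlIntegralLine_eq_fracInt, hord] at hF
  rw [hd] at hqi hQ hK
  have hF0 := fracInt_eq_zero (β := 2 - α) ha
  have hv4 := eq_fracInt_iteratedDeriv h1 h2 hvc ha hF
  have h22 := iteratedDeriv_two_eq_fracInt hF hF0
  have hqc : Continuous (iteratedDeriv 4 (fracInt (2 - α) v)) :=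
    hF.continuous_iteratedDeriv 4 le_rfl
  have hq0 : ∀ x ≤ a, iteratedDeriv 4 (fracInt (2 - α) v) x = 0 :=
    iteratedDeriv_eq_zero_of_causal hF hF0
  rw [h22]
  -- Hiding that q is built from v lets the rewrite by `hv4` act only on the values of v in the sum.
  generalize iteratedDeriv 4 (fracInt (2 - α) v) = q at *
  rw [hv4]
  have hlim : Tendsto (fun σ => |1 / h ^ α * (∑ k ∈ Finset.range n, weight α k *
        Real.exp (-(((k : ℝ) - 1) * (h * σ))) *
        dampedInt (α + 2) σ q (x - ((k : ℝ) - 1) * h)) - dampedInt 2 σ q x|) (𝓝[>] 0)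
      (𝓝 |1 / h ^ α * (∑ k ∈ Finset.range n, weight α k *
        fracInt (α + 2) q (x - ((k : ℝ) - 1) * h)) - fracInt 2 q x|) := by
    refine Tendsto.abs (Tendsto.sub (Tendsto.const_mul _ (tendsto_finsetSum _ fun k _ => ?_))
      (tendsto_dampedInt two_pos hqc hq0 x))
    refine Tendsto.mul ?_ (tendsto_dampedInt (by linarith) hqc hq0 _)
    have : Continuous fun σ : ℝ => weight α k * Real.exp (-(((k : ℝ) - 1) * (h * σ))) := by
      fun_prop
    have ht := this.tendsto 0
    simp only [mul_zero, neg_zero, Real.exp_zero, mul_one] at ht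
    exact ht.mono_left nhdsWithin_le_nhds
  refine le_of_tendsto hlim ?_
  -- The restriction σ ≤ 1/h keeps Re(hz) ≤ 1, as the symbol estimate requires.
  filter_upwards [Ioc_mem_nhdsGT (show (0 : ℝ) < 1 / h by positivity)] with σ hσ
  have hhσ : h * σ ≤ 1 := by
    have := mul_le_mul_of_nonneg_left hσ.2 hh.le
    rwa [mul_one_div_cancel hh.ne'] at this
  refine (norm_damped_error_le h1 h2 hh hσ.1 hhσ hC hqc hqi hQ hq0 hn).trans ?_
  rw [mul_right_comm]
  gcongr

end OSFDE

/-! ### Consistency of the scheme on the grid -/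

namespace OSFDE

open Set

/-- Index j stands for the grid point j + 1, so `V M` is the right boundary value. The last row
would need it; as it is 0, that row has the same form as the others. -/
theorem gMatrix_mulVec_eq_sum (α : ℝ) {M : ℕ} (i : Fin M) (V : ℕ → ℝ) (hV : V M = 0) :
    (gMatrix α M *ᵥ fun j => V j) i =
      ∑ k ∈ Finset.range ((i : ℕ) + 2), weight α k * V (i + 1 - k) := by
  have h1 : (gMatrix α M *ᵥ fun j => V j) i = ∑ j : Fin M,
      (fun j : ℕ => if j ≤ (i : ℕ) + 1 then weight α (i + 1 - j) * V j else 0) j := by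
    simp only [Matrix.mulVec, dotProduct, gMatrix, Matrix.of_apply, ite_mul, zero_mul]
  rw [h1, Fin.sum_univ_eq_sum_range
    (fun j : ℕ => if j ≤ (i : ℕ) + 1 then weight α (i + 1 - j) * V j else 0) M]
  have h2 := Finset.sum_range_succ
    (fun j : ℕ => if j ≤ (i : ℕ) + 1 then weight α (i + 1 - j) * V j else 0) M
  simp only [hV, mul_zero, ite_self, add_zero] at h2
  rw [← h2, ← Finset.sum_filter]
  have hi := i.isLt
  have h3 : (Finset.range (M + 1)).filter (fun j => j ≤ (i : ℕ) + 1) =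
      Finset.range ((i : ℕ) + 2) := by
    ext j; simp; omega
  rw [h3, ← Finset.sum_range_reflect]
  refine Finset.sum_congr rfl fun k hk => ?_
  rw [Finset.mem_range] at hk
  congr 2
  omega

theorem spaceStep_pos {xL xR : ℝ} (hx : xL < xR) (M : ℕ) : 0 < spaceStep xL xR M :=
  div_pos (sub_pos.2 hx) (by positivity)

theorem succ_mul_spaceStep (xL xR : ℝ) (M : ℕ) :
    ((M : ℝ) + 1) * spaceStep xL xR M = xR - xL := by
  rw [spaceStep]; field_simp

theorem gridPoint_mem_Ioo {xL xR : ℝ} (hx : xL < xR) {M : ℕ} (i : Fin M) :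
    gridPoint xL xR M i ∈ Ioo xL xR := by
  have hh := spaceStep_pos hx M
  have hM := succ_mul_spaceStep xL xR M
  have hi : ((i : ℕ) : ℝ) + 1 ≤ M := by exact_mod_cast i.isLt
  rw [gridPoint]
  constructor
  · have : 0 < (((i : ℕ) : ℝ) + 1) * spaceStep xL xR M := by positivity
    linarith
  · nlinarith

theorem timeStep_pos {T : ℝ} (hT : 0 < T) {N : ℕ} (hN : 0 < N) : 0 < timeStep T N :=
  div_pos hT (by exact_mod_cast hN)

theorem timeLevel_le {T : ℝ} (hT : 0 < T) {N n : ℕ} (hN : 0 < N) (hn : n ≤ N) :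
    timeLevel T N n ≤ T := by
  have hN' : (0 : ℝ) < N := by exact_mod_cast hN
  have hn' : (n : ℝ) ≤ N := by exact_mod_cast hn
  rw [timeLevel, timeStep, ← mul_div_assoc, div_le_iff₀ hN', mul_comm]
  gcongr

/-- Second order consistency in space of the matrix `G_α` on the grid. -/
theorem exists_gMatrix_error_le {α xL xR T : ℝ} (h1 : 1 < α) (h2 : α < 2) (hx : xL < xR)
    {u : ℝ → ℝ → ℝ} (hright : ∀ t ∈ Icc 0 T, u xR t = 0)
    (hsmooth : IsSufficientlySmooth α xL xR T u) :
    ∃ C, 0 ≤ C ∧ ∀ t ∈ Icc 0 T, ∀ (M : ℕ) (i : Fin M),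
      |1 / spaceStep xL xR M ^ α *
          (gMatrix α M *ᵥ fun j => u (gridPoint xL xR M j) t) i -
        rlDeriv xL α (fun y => u y t) (gridPoint xL xR M i)| ≤ C * spaceStep xL xR M ^ 2 := by
  obtain ⟨C, hC0, hC⟩ := exists_grunwald_error_le h1 h2
  obtain ⟨K, hK⟩ := hsmooth.space
  refine ⟨C * |K|, by positivity, fun t ht M i => ?_⟩
  obtain ⟨v, hv0, hvu, hreg⟩ := hK t ht
  have hh := spaceStep_pos hx M
  set h := spaceStep xL xR M with hhdef
  have hxi := gridPoint_mem_Ioo hx i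
  have hend : xL + ((M : ℝ) + 1) * h = xR := by
    rw [hhdef, succ_mul_spaceStep]; ring
  obtain ⟨V, hV⟩ : ∃ V : ℕ → ℝ, ∀ j, V j = v (xL + ((j : ℝ) + 1) * h) := ⟨_, fun _ => rfl⟩
  have hgrid : (fun j : Fin M => u (gridPoint xL xR M j) t) = fun j : Fin M => V j := by
    ext j
    rw [← hvu _ (Ioo_subset_Icc_self (gridPoint_mem_Ioo hx j)), hV]
    rfl
  have hVM : V M = 0 := by
    rw [hV, hend, hvu xR ⟨hx.le, le_rfl⟩, hright t ht]
  rw [hgrid, gMatrix_mulVec_eq_sum α i V hVM, rlDeriv_eq_iteratedDeriv hv0 hvu hxi]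
  -- With i + 2 terms the first omitted node is exactly xL, where v already vanishes.
  have key := hC K v xL hreg hv0 h (gridPoint xL xR M i) ((i : ℕ) + 2) hh (by
    rw [gridPoint, ← hhdef]; push_cast; linarith)
  have hsum : ∑ k ∈ Finset.range ((i : ℕ) + 2),
      weight α k * v (gridPoint xL xR M i - ((k : ℝ) - 1) * h) =
      ∑ k ∈ Finset.range ((i : ℕ) + 2), weight α k * V (i + 1 - k) := by
    refine Finset.sum_congr rfl fun k hk => ?_
    rw [Finset.mem_range] at hk
    rw [gridPoint, ← hhdef, hV, Nat.cast_sub (by omega)]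
    congr 2
    push_cast
    ring
  rw [hsum] at key
  refine key.trans ?_
  gcongr
  exact le_abs_self K

/-- The local truncation error of the Crank-Nicolson scheme. -/
theorem exists_truncation_error_le {α xL xR T dMin dMax : ℝ} (h1 : 1 < α) (h2 : α < 2)
    (hx : xL < xR) (hT : 0 < T) {d φ : ℝ → ℝ} {f u : ℝ → ℝ → ℝ} (hdMin : 0 < dMin)
    (hd : ∀ x ∈ Ioo xL xR, dMin ≤ d x ∧ d x ≤ dMax)
    (hu : IsExactSolution α xL xR T d φ f u) (hsmooth : IsSufficientlySmooth α xL xR T u) :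
    ∃ R, 0 ≤ R ∧ ∀ M N : ℕ, 0 < N → ∀ n < N, ∀ i : Fin M,
      |(u (gridPoint xL xR M i) (timeLevel T N (n + 1)) -
            u (gridPoint xL xR M i) (timeLevel T N n)) / timeStep T N -
          1 / (2 * spaceStep xL xR M ^ α) * (d (gridPoint xL xR M i) *
            (gMatrix α M *ᵥ fun j => u (gridPoint xL xR M j) (timeLevel T N n) +
              u (gridPoint xL xR M j) (timeLevel T N (n + 1))) i) -
          f (gridPoint xL xR M i) ((timeLevel T N n + timeLevel T N (n + 1)) / 2)| ≤
        R * (timeStep T N ^ 2 + spaceStep xL xR M ^ 2) := by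
  obtain ⟨C, hC0, hC⟩ := exists_gMatrix_error_le h1 h2 hx hu.right_boundary hsmooth
  obtain ⟨K₁, hK₁⟩ := hsmooth.time
  obtain ⟨K₂, hK₂⟩ := hsmooth.time_rlDeriv
  have hmid : (xL + xR) / 2 ∈ Ioo xL xR := ⟨by linarith, by linarith⟩
  have hdMax : 0 < dMax := hdMin.trans_le ((hd _ hmid).1.trans (hd _ hmid).2)
  have h0T : (0 : ℝ) ∈ Icc 0 T := ⟨le_rfl, hT.le⟩
  have hK₁0 : 0 ≤ K₁ := (abs_nonneg _).trans ((hK₁ _ hmid).2 0 h0T)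
  have hK₂0 : 0 ≤ K₂ := (abs_nonneg _).trans ((hK₂ _ hmid).2 0 h0T)
  refine ⟨K₁ + dMax * K₂ + dMax * C, by positivity, fun M N hN n hn i => ?_⟩
  have hτ := timeStep_pos hT hN
  have hh := spaceStep_pos hx M
  have hxi := gridPoint_mem_Ioo hx i
  set x := gridPoint xL xR M i
  set h := spaceStep xL xR M
  set τ := timeStep T N
  have hab : timeLevel T N (n + 1) - timeLevel T N n = τ := by
    simp only [timeLevel]; push_cast; ring
  have ha : 0 ≤ timeLevel T N n := mul_nonneg (Nat.cast_nonneg n) hτ.le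
  have hb : timeLevel T N (n + 1) ≤ T := timeLevel_le hT hN hn
  set a := timeLevel T N n
  set b := timeLevel T N (n + 1)
  have hlt : a < b := by linarith
  have e1 := abs_slope_sub_deriv_midpoint_le (hK₁ x hxi).1 (hK₁ x hxi).2 ha hlt hb
  have e2 := abs_average_sub_midpoint_le (hK₂ x hxi).1 (hK₂ x hxi).2 ha hlt hb
  have e3 := hC a ⟨ha, by linarith⟩ M i
  have e4 := hC b ⟨by linarith, hb⟩ M i
  have hm : (a + b) / 2 ∈ Ioc 0 T := ⟨by linarith, by linarith⟩
  have heq := (hu.equation ((a + b) / 2) hm x hxi).derivWithin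
    (uniqueDiffOn_Icc hT _ (Ioc_subset_Icc_self hm))
  rw [heq, hab] at e1
  rw [hab] at e2
  have hsplit : (gMatrix α M *ᵥ fun j => u (gridPoint xL xR M j) a + u (gridPoint xL xR M j) b) i =
      (gMatrix α M *ᵥ fun j => u (gridPoint xL xR M j) a) i +
        (gMatrix α M *ᵥ fun j => u (gridPoint xL xR M j) b) i := by
    rw [← Pi.add_apply, ← Matrix.mulVec_add]; rfl
  rw [hsplit]
  have hha : h ^ α ≠ 0 := (Real.rpow_pos_of_pos hh α).ne'
  generalize (gMatrix α M *ᵥ fun j => u (gridPoint xL xR M j) a) i = A at *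
  generalize (gMatrix α M *ᵥ fun j => u (gridPoint xL xR M j) b) i = B at *
  generalize rlDeriv xL α (fun y => u y a) x = Pa at *
  generalize rlDeriv xL α (fun y => u y b) x = Pb at *
  generalize rlDeriv xL α (fun y => u y ((a + b) / 2)) x = Pm at *
  obtain ⟨hd1, hd2⟩ := hd x hxi
  have hd0 : 0 ≤ d x := hdMin.le.trans hd1
  -- Three errors: the difference quotient against the equation at the midpoint, the time average of
  -- the fractional derivative, and the space discretization at both time levels.
  have hdecomp : (u x b - u x a) / τ - 1 / (2 * h ^ α) * (d x * (A + B)) - f x ((a + b) / 2) =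
      ((u x b - u x a) / τ - (d x * Pm + f x ((a + b) / 2))) - d x * ((Pa + Pb) / 2 - Pm) -
        d x / 2 * ((1 / h ^ α * A - Pa) + (1 / h ^ α * B - Pb)) := by
    field_simp
    ring
  rw [hdecomp]
  have t2 : |d x * ((Pa + Pb) / 2 - Pm)| ≤ dMax * (K₂ * τ ^ 2) := by
    rw [abs_mul, abs_of_nonneg hd0]; gcongr
  have t3 : |d x / 2 * ((1 / h ^ α * A - Pa) + (1 / h ^ α * B - Pb))| ≤
      dMax / 2 * (C * h ^ 2 + C * h ^ 2) := by
    rw [abs_mul, abs_of_nonneg (by positivity)]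
    gcongr
    exact (abs_add_le _ _).trans (add_le_add e3 e4)
  refine (abs_sub _ _).trans ?_
  refine (add_le_add ((abs_sub _ _).trans (add_le_add e1 t2)) t3).trans ?_
  have p1 : 0 ≤ K₁ * h ^ 2 := by positivity
  have p2 : 0 ≤ dMax * K₂ * h ^ 2 := by positivity
  have p3 : 0 ≤ dMax * C * τ ^ 2 := by positivity
  linarith

end OSFDE

/-! ### Convergence -/

theorem theorem2p5 (α xL xR T dMin dMax : ℝ) (hα₁ : 1 < α) (hα₂ : α < 2) (hx : xL < xR)
    (hT : 0 < T) (d φ : ℝ → ℝ) (f u : ℝ → ℝ → ℝ) (hdMin : 0 < dMin)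
    (hd : ∀ x ∈ Set.Ioo xL xR, dMin ≤ d x ∧ d x ≤ dMax)
    (hu : OSFDE.IsExactSolution α xL xR T d φ f u)
    (hsmooth : OSFDE.IsSufficientlySmooth α xL xR T u) :
    ∃ c₂ : ℝ, 0 < c₂ ∧ ∀ M N : ℕ, 0 < M → 0 < N → ∀ U : ℕ → Fin M → ℝ,
      OSFDE.IsSchemeSolution α xL xR T d φ f M N U → ∀ n ≤ N,
        OSFDE.discreteNorm (OSFDE.spaceStep xL xR M)
            (fun i => u (OSFDE.gridPoint xL xR M i) (OSFDE.timeLevel T N n) - U n i) ≤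
          c₂ * (OSFDE.timeStep T N ^ 2 + OSFDE.spaceStep xL xR M ^ 2) := by
  open OSFDE in
  obtain ⟨R, hR0, hR⟩ := exists_truncation_error_le hα₁ hα₂ hx hT hdMin hd hu hsmooth
  have hmid : (xL + xR) / 2 ∈ Set.Ioo xL xR := ⟨by linarith, by linarith⟩
  have hdMax : 0 < dMax := hdMin.trans_le ((hd _ hmid).1.trans (hd _ hmid).2)
  have hl : 0 < xR - xL := sub_pos.2 hx
  -- T bounds nτ, R is the truncation constant, dMax/dMin pays for passing to the weighted norm and
  -- back, and xR - xL bounds Mh. The summand 1 only ensures positivity.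
  refine ⟨T * √(dMax * (xR - xL) / dMin) * R + 1, by positivity, fun M N _ hN U hU => ?_⟩
  have hτ := timeStep_pos hT hN
  have hh := spaceStep_pos hx M
  have hM := succ_mul_spaceStep xL xR M
  set h := spaceStep xL xR M with hhdef
  set τ := timeStep T N with hτdef
  set δ : Fin M → ℝ := fun i => d (gridPoint xL xR M i) with hδdef
  have hδ1 : ∀ i, dMin ≤ δ i := fun i => (hd _ (gridPoint_mem_Ioo hx i)).1
  have hδ2 : ∀ i, δ i ≤ dMax := fun i => (hd _ (gridPoint_mem_Ioo hx i)).2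
  have hδ0 : ∀ i, 0 < δ i := fun i => hdMin.trans_le (hδ1 i)
  set e : ℕ → Fin M → ℝ := fun n i => u (gridPoint xL xR M i) (timeLevel T N n) - U n i with hedef
  set S := √(M / dMin) * (R * (τ ^ 2 + h ^ 2)) with hSdef
  have hstep : ∀ n < N, √(∑ i, e (n + 1) i ^ 2 / δ i) ≤ √(∑ i, e n i ^ 2 / δ i) + τ * S := by
    intro n hn
    -- The residual of the error equation is the truncation error of u, since U satisfies the scheme
    -- exactly.
    set ρ : Fin M → ℝ := fun i => (e (n + 1) i - e n i) / τ -
      1 / (2 * h ^ α) * (δ i * (gMatrix α M *ᵥ (e n + e (n + 1))) i) with hρdef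
    have hρ : ∀ i, |ρ i| ≤ R * (τ ^ 2 + h ^ 2) := by
      intro i
      refine le_of_eq_of_le (congrArg _ ?_) (hR M N hN n hn i)
      have hs := congrFun (hU.step n hn) i
      simp only [Pi.smul_apply, Pi.add_apply, Pi.sub_apply, smul_eq_mul, ← Matrix.mulVec_mulVec,
        dMatrix, Matrix.mulVec_diagonal] at hs
      have hlin : e n + e (n + 1) = (fun j => u (gridPoint xL xR M j) (timeLevel T N n) +
          u (gridPoint xL xR M j) (timeLevel T N (n + 1))) - (U n + U (n + 1)) := by
        ext j; simp only [hedef, Pi.add_apply, Pi.sub_apply]; ring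
      simp only [hρdef]
      rw [hlin, Matrix.mulVec_sub, Pi.sub_apply]
      simp only [hedef, hδdef]
      rw [← hτdef, ← hhdef] at hs ⊢
      linear_combination -hs
    refine (sqrt_energy_step (e := e n) (e' := e (n + 1)) (ρ := ρ) hα₁ hα₂ hδ0 hτ (c := 1 / (2 * h ^ α)) (by positivity)
      fun i => by simp only [hρdef]; ring).trans ?_
    refine add_le_add le_rfl (mul_le_mul_of_nonneg_left ?_ hτ.le)
    have hle : ∑ i, ρ i ^ 2 / δ i ≤ M / dMin * (R * (τ ^ 2 + h ^ 2)) ^ 2 := by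
      calc ∑ i, ρ i ^ 2 / δ i ≤ ∑ _i : Fin M, (R * (τ ^ 2 + h ^ 2)) ^ 2 / dMin := by
            refine Finset.sum_le_sum fun i _ => ?_
            have := hδ1 i
            have h2 : ρ i ^ 2 ≤ (R * (τ ^ 2 + h ^ 2)) ^ 2 :=
              sq_le_sq' (abs_le.1 (hρ i)).1 (abs_le.1 (hρ i)).2
            gcongr
        _ = _ := by
            rw [Finset.sum_const, Finset.card_univ, Fintype.card_fin, nsmul_eq_mul]; ring
    refine (Real.sqrt_le_sqrt hle).trans (le_of_eq ?_)
    rw [Real.sqrt_mul (by positivity), Real.sqrt_sq (by positivity)]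
  have hind : ∀ n ≤ N, √(∑ i, e n i ^ 2 / δ i) ≤ n * (τ * S) := by
    intro n
    induction n with
    | zero =>
      intro _
      have h0 : ∀ i, e 0 i = 0 := fun i => by
        simp only [hedef, timeLevel, Nat.cast_zero, zero_mul]
        rw [hU.initial, hu.initial _ (Set.Ioo_subset_Icc_self (gridPoint_mem_Ioo hx i)), sub_self]
      simp [h0]
    | succ n ih =>
      intro hn
      have := ih (by omega)
      have h2 := hstep n (by omega)
      push_cast
      linarith
  intro n hn
  have hnT : (n : ℝ) * τ ≤ T := timeLevel_le hT hN hn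
  have hS0 : 0 ≤ S := by positivity
  have hE : √(∑ i, e n i ^ 2 / δ i) ≤ T * S :=
    (hind n hn).trans (by rw [← mul_assoc]; gcongr)
  have hnorm : discreteNorm h (e n) ≤ √(h * dMax) * √(∑ i, e n i ^ 2 / δ i) := by
    rw [discreteNorm, ← Real.sqrt_mul (by positivity), mul_assoc, Finset.mul_sum]
    refine Real.sqrt_le_sqrt (mul_le_mul_of_nonneg_left (Finset.sum_le_sum fun i _ => ?_) hh.le)
    rw [← mul_div_assoc, le_div_iff₀ (hδ0 i), ← sq, mul_comm]
    exact mul_le_mul_of_nonneg_right (hδ2 i) (sq_nonneg _)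
  have hfactor : √(h * dMax) * √(M / dMin) ≤ √(dMax * (xR - xL) / dMin) := by
    rw [← Real.sqrt_mul (by positivity)]
    refine Real.sqrt_le_sqrt ?_
    rw [show h * dMax * (M / dMin) = dMax * (M * h) / dMin by ring]
    gcongr
    linarith
  calc discreteNorm h (e n) ≤ √(h * dMax) * (T * S) := hnorm.trans (by gcongr)
    _ = T * (√(h * dMax) * √(M / dMin)) * R * (τ ^ 2 + h ^ 2) := by rw [hSdef]; ring
    _ ≤ T * √(dMax * (xR - xL) / dMin) * R * (τ ^ 2 + h ^ 2) := by gcongr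
    _ ≤ (T * √(dMax * (xR - xL) / dMin) * R + 1) * (τ ^ 2 + h ^ 2) := by
        gcongr; linarith
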